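/- Let $L>0$ and $P_0,P_1,V_0,V_1\in\mathbf{R}^3$ with $|P_0-P_1|<L$ and $|V_0|=|V_1|=1$. Let $$\mathcal{A}:=\{\gamma\in W^{2,2}(0,L;\mathbf{R}^3) \mid |\gamma'|\equiv 1,\ \gamma(0)=P_0,\ \gamma(L)=P_1,\ \gamma'(0)=V_0,\ \gamma'(L)=V_1\}$$ be the set of clamped, arclength parametrized curves of length $L$, where each curve is identified with its $C^1([0,L])$-representative, equipped with the topology induced by the $W^{2,2}(0,L)$-norm, and let $$\mathcal{B}[\gamma]:=\int_0^L|\gamma''(s)|^2\,ds$$ be the bending energy. Call $\gamma\in\mathcal{A}$ a local minimizer of $\mathcal{B}$ in $\mathcal{A}$ if there is $\delta>0$ such that $\mathcal{B}[\gamma]\le\mathcal{B}[\xi]$ for all $\xi\in\mathcal{A}$ with $\|\xi-\gamma\|_{W^{2,2}}<\delta$. **Theorem (Rigidity for spatially stable elasticae).** Let $\gamma\in\mathcal{A}$. Suppose that there are $0\le s_1<s_2\le L$ with $s_2-s_1<L$ such that the vectors $\gamma(s_2)-\gamma(s_1)$, $\gamma'(s_1)$, $\gamma'(s_2)$ are all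 parallel (i.e. lie on one line through the origin; the first may vanish), and such that $\gamma''(s_1)\neq0$ or $\gamma''(s_2)\neq0$, meaning that the classical second derivative (one-sided at the endpoints of $[0,L]$) exists at the point in question and does not vanish. Then $\gamma$ is not a local minimizer of $\mathcal{B}$ in $\mathcal{A}$. -/

import Mathlib

open MeasureTheory Set
open scoped ContDiff

namespace Elastica

/-- Euclidean three-space. -/
abbrev E3 : Type := EuclideanSpace ℝ (Fin 3)

/-- `v` is a weak derivative of `u` on the open interval `(0, L)`: both are locally integrable
there, and integration by parts holds against every smooth function with compact support
in `(0, L)`. -/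
def IsWeakDeriv (L : ℝ) (u v : ℝ → E3) : Prop :=
  LocallyIntegrableOn u (Ioo 0 L) volume ∧ LocallyIntegrableOn v (Ioo 0 L) volume ∧
    ∀ φ : ℝ → ℝ, ContDiff ℝ ∞ φ → HasCompactSupport φ → tsupport φ ⊆ Ioo 0 L →
      ∫ s in Ioo 0 L, deriv φ s • u s = -∫ s in Ioo 0 L, φ s • v s

/-- The weak derivative of `u` on `(0, L)`. It is unique up to null sets; it is set to `0`
if `u` has no weak derivative. -/
noncomputable def weakDeriv (L : ℝ) (u : ℝ → E3) : ℝ → E3 :=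
  open Classical in if h : ∃ v, IsWeakDeriv L u v then h.choose else 0

/-- Membership in the Sobolev space `W^{2,2}(0, L; ℝ³)`: the function and its first and second
weak derivatives exist and are square integrable on `(0, L)`. -/
def MemW22 (L : ℝ) (u : ℝ → E3) : Prop :=
  MemLp u 2 (volume.restrict (Ioo 0 L)) ∧
    ∃ v w : ℝ → E3, IsWeakDeriv L u v ∧ IsWeakDeriv L v w ∧
      MemLp v 2 (volume.restrict (Ioo 0 L)) ∧ MemLp w 2 (volume.restrict (Ioo 0 L))

/-- The `W^{2,2}(0, L)`-norm
`(∫ |u|² + ∫ |u'|² + ∫ |u''|²)^{1/2}`, with weak derivatives. -/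
noncomputable def normW22 (L : ℝ) (u : ℝ → E3) : ℝ :=
  Real.sqrt ((∫ s in Ioo 0 L, ‖u s‖ ^ 2) + (∫ s in Ioo 0 L, ‖weakDeriv L u s‖ ^ 2) +
    ∫ s in Ioo 0 L, ‖weakDeriv L (weakDeriv L u) s‖ ^ 2)

/-- The derivative of a curve on the closed interval `[0, L]`, one-sided at the endpoints. -/
noncomputable def derivIcc (L : ℝ) (u : ℝ → E3) : ℝ → E3 :=
  derivWithin u (Icc 0 L)

/-- `W^{2,2}_arc(0, L; ℝ³)`: arclength parametrized `W^{2,2}`-curves. As usual, an element of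
`W^{2,2}(0, L; ℝ³)` is identified with its representative of class `C¹` on `[0, L]`, so that the
curve and its tangent have values at every point of `[0, L]`. Values of the function
outside `[0, L]` play no role. -/
def W22Arc (L : ℝ) : Set (ℝ → E3) :=
  {γ | MemW22 L γ ∧ ContDiffOn ℝ 1 γ (Icc 0 L) ∧ ∀ s ∈ Icc 0 L, ‖derivIcc L γ s‖ = 1}

/-- The admissible set for the clamped boundary condition with endpoints `P₀`, `P₁` and end
tangents `V₀`, `V₁`. -/
def clampedCurves (L : ℝ) (P₀ P₁ V₀ V₁ : E3) : Set (ℝ → E3) :=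
  {γ | γ ∈ W22Arc L ∧ γ 0 = P₀ ∧ γ L = P₁ ∧ derivIcc L γ 0 = V₀ ∧ derivIcc L γ L = V₁}

/-- The bending energy `∫ |κ|² ds` with `κ = γ''` of an arclength parametrized curve. -/
noncomputable def bendingEnergy (L : ℝ) (γ : ℝ → E3) : ℝ :=
  ∫ s in Ioo 0 L, ‖weakDeriv L (weakDeriv L γ) s‖ ^ 2

/-- `γ` is a local minimizer of the bending energy in the set `A`, with respect to the
topology on `A` induced by the `W^{2,2}`-norm. -/
def IsLocalMinimizer (L : ℝ) (A : Set (ℝ → E3)) (γ : ℝ → E3) : Prop :=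
  γ ∈ A ∧ ∃ δ > 0, ∀ ξ ∈ A, normW22 L (ξ - γ) < δ → bendingEnergy L γ ≤ bendingEnergy L ξ

/-- Three vectors are parallel if they all lie on one line through the origin. -/
def AreParallel (a b c : E3) : Prop :=
  ∃ e : E3, a ∈ Submodule.span ℝ {e} ∧ b ∈ Submodule.span ℝ {e} ∧ c ∈ Submodule.span ℝ {e}

end Elastica

/-! Suppose `γ` is a local minimizer, and let `e` span a line containing the chord `γ s₂ - γ s₁` and
both tangents at `s₁`, `s₂`. Rotating only the arc over `(s₁, s₂)` about `e` fixes the chord and the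
two tangents, so the new curve is still of class `W^{2,2}` and satisfies the same clamped
conditions. Its energy is unchanged, because a rotation preserves the norm of the curvature vector.
For a small angle it is so close to `γ` that it is itself a local minimizer
(`isLocalMinField_of_close`).

Local minimizers are elasticae (`exists_isElastica`): their curvature vector is continuous on `[0,
L]` and solves a second order ODE for the tangent. Since `s₂ - s₁ < L`, the two curves agree on an
open interval at one end of `[0, L]`, and unique continuation (`IsElastica.eqOn_of_eqOn_Ioo`) makes
their curvature vectors agree everywhere. At an endpoint of the arc where the curvature vector does
not vanish, it is orthogonal to the tangent, hence to `e`, so the rotation of `exists_rotation`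
moves it. This is a contradiction.

The problem is first rewritten in terms of the curvature field `w = γ''`, extended by zero: the
tangent is a primitive of `w`, the energy is `∫ ‖w‖²`, and the constraints become `IsAdmissible`.
The Euler–Lagrange equation comes from varying the tangent `T` to the radial projection of `T + φ`.
This keeps unit speed exactly, and leaves the displacement as the only constraint.
Finite-dimensional families of such variations give a Lagrange multiplier. The abnormal case, where
the multiplier of the energy vanishes, would force a straight segment, which `‖P₀ - P₁‖ < L`
excludes. -/

namespace Elastica

open Filter Topology

local notation "⟪" x ", " y "⟫" => inner ℝ x y

/-! ### Absolutely continuous functions as primitives. -/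

section Primitive

variable {E : Type*} [NormedAddCommGroup E] [NormedSpace ℝ E]

/-- `g` is locally integrable and `f` is a primitive of `g`. -/
def IsPrimitive (f g : ℝ → E) : Prop :=
  LocallyIntegrable g volume ∧ ∀ a b : ℝ, ∫ t in a..b, g t = f b - f a

/-- Serves twice: to compare a vector primitive with the integral of `‖g‖`, and to compose a
primitive with a Lipschitz map. -/
theorem absolutelyContinuousOnInterval_of_dist_le {X Y : Type*} [PseudoMetricSpace X]
    [PseudoMetricSpace Y] {f : ℝ → X} {g : ℝ → Y} {a b : ℝ}
    (hg : AbsolutelyContinuousOnInterval g a b) (C : ℝ)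
    (h : ∀ x y, dist (f x) (f y) ≤ C * dist (g x) (g y)) :
    AbsolutelyContinuousOnInterval f a b := by
  unfold AbsolutelyContinuousOnInterval at hg ⊢
  refine squeeze_zero (fun _ ↦ Finset.sum_nonneg fun _ _ ↦ dist_nonneg) (fun E ↦ ?_)
    (by simpa using hg.const_mul C)
  rw [Finset.mul_sum]
  exact Finset.sum_le_sum fun i _ ↦ h _ _

omit [NormedSpace ℝ E] in
theorem intervalIntegrable_of_locallyIntegrable {g : ℝ → E} (hg : LocallyIntegrable g volume)
    (a b : ℝ) : IntervalIntegrable g volume a b :=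
  (hg.integrableOn_isCompact isCompact_uIcc).intervalIntegrable

theorem isPrimitive_integral {g : ℝ → E} (hg : LocallyIntegrable g volume) (c : E) :
    IsPrimitive (fun s ↦ c + ∫ t in (0 : ℝ)..s, g t) g := by
  refine ⟨hg, fun a b ↦ ?_⟩
  have hi := intervalIntegrable_of_locallyIntegrable hg
  rw [← intervalIntegral.integral_add_adjacent_intervals (hi a 0) (hi 0 b),
    intervalIntegral.integral_symm]
  beta_reduce
  abel

namespace IsPrimitive

variable {f g f₁ g₁ f₂ g₂ : ℝ → E}

theorem eq (h : IsPrimitive f g) (s : ℝ) : f s = f 0 + ∫ t in (0 : ℝ)..s, g t := by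
  rw [h.2]; abel

theorem absolutelyContinuous (h : IsPrimitive f g) (a b : ℝ) :
    AbsolutelyContinuousOnInterval f a b := by
  have hn : ∀ a b, IntervalIntegrable (fun s ↦ ‖g s‖) volume a b := fun a b ↦
    (intervalIntegrable_of_locallyIntegrable h.1 a b).norm
  refine absolutelyContinuousOnInterval_of_dist_le
    ((hn a b).absolutelyContinuousOnInterval_intervalIntegral (c := a) (by simp)) 1 fun x y ↦ ?_
  rw [one_mul, dist_comm, dist_eq_norm, ← h.2 x y, dist_comm, Real.dist_eq,
    ← intervalIntegral.integral_add_adjacent_intervals (hn a x) (hn x y), add_sub_cancel_left]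
  exact intervalIntegral.norm_integral_le_abs_integral_norm

theorem continuous (h : IsPrimitive f g) : Continuous f := by
  have : f = fun s ↦ f 0 + ∫ t in (0 : ℝ)..s, g t := funext h.eq
  rw [this]
  exact continuous_const.add (intervalIntegral.continuous_primitive
    (intervalIntegrable_of_locallyIntegrable h.1) 0)

theorem ae_hasDerivAt [CompleteSpace E] (h : IsPrimitive f g) :
    ∀ᵐ s, HasDerivAt f (g s) s := by
  have : f = fun s ↦ f 0 + ∫ t in (0 : ℝ)..s, g t := funext h.eq
  filter_upwards [_root_.LocallyIntegrable.ae_hasDerivAt_integral h.1] with s hs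
  rw [this]
  exact (hs 0).const_add _

/-- The difference of `f` and the indefinite integral of `g` is absolutely continuous with
derivative zero almost everywhere, hence constant. -/
theorem of_absolutelyContinuous [CompleteSpace E] (hg : LocallyIntegrable g volume)
    (hf : ∀ a b, AbsolutelyContinuousOnInterval f a b) (hd : ∀ᵐ s, HasDerivAt f (g s) s) :
    IsPrimitive f g := by
  refine ⟨hg, fun a b ↦ ?_⟩
  have hp := isPrimitive_integral hg 0
  obtain ⟨C, hC⟩ := ((hf a b).fun_sub (hp.absolutelyContinuous a b)).const_of_ae_hasDerivAt_zero (by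
    filter_upwards [hd, hp.ae_hasDerivAt] with s h1 h2 _
    simpa using h1.fun_sub h2)
  have h1 := hC a (by simp)
  have h2 := hC b (by simp)
  have h3 := hp.2 a b
  rw [h3]
  have := h1.trans h2.symm
  rw [sub_eq_sub_iff_add_eq_add] at this ⊢
  rw [add_comm, ← this, add_comm]

theorem of_hasDerivAt [CompleteSpace E] (hg : Continuous g) (hd : ∀ s, HasDerivAt f (g s) s) :
    IsPrimitive f g :=
  ⟨hg.locallyIntegrable, fun a b ↦ intervalIntegral.integral_eq_sub_of_hasDerivAt
    (fun s _ ↦ hd s) (hg.intervalIntegrable a b)⟩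

theorem smul [CompleteSpace E] {φ φ' : ℝ → ℝ} (hφ : IsPrimitive φ φ') (h : IsPrimitive f g) :
    IsPrimitive (fun s ↦ φ s • f s) (fun s ↦ φ' s • f s + φ s • g s) := by
  refine of_absolutelyContinuous ?_
    (fun a b ↦ (hφ.absolutelyContinuous a b).fun_smul (h.absolutelyContinuous a b)) ?_
  · refine LocallyIntegrable.add ?_ ?_
    · rw [← locallyIntegrableOn_univ]
      exact (locallyIntegrableOn_univ.2 hφ.1).smul_continuousOn isOpen_univ.isLocallyClosed
        h.continuous.continuousOn
    · rw [← locallyIntegrableOn_univ]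
      exact (locallyIntegrableOn_univ.2 h.1).continuousOn_smul isOpen_univ.isLocallyClosed
        hφ.continuous.continuousOn
  · filter_upwards [hφ.ae_hasDerivAt, h.ae_hasDerivAt] with s h1 h2
    rw [add_comm]
    exact h1.smul h2

theorem add (h₁ : IsPrimitive f₁ g₁) (h₂ : IsPrimitive f₂ g₂) :
    IsPrimitive (fun s ↦ f₁ s + f₂ s) (fun s ↦ g₁ s + g₂ s) := by
  refine ⟨h₁.1.add h₂.1, fun a b ↦ ?_⟩
  rw [intervalIntegral.integral_add (intervalIntegrable_of_locallyIntegrable h₁.1 a b)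
    (intervalIntegrable_of_locallyIntegrable h₂.1 a b), h₁.2, h₂.2]
  beta_reduce
  abel

theorem sub (h₁ : IsPrimitive f₁ g₁) (h₂ : IsPrimitive f₂ g₂) :
    IsPrimitive (fun s ↦ f₁ s - f₂ s) (fun s ↦ g₁ s - g₂ s) := by
  refine ⟨h₁.1.sub h₂.1, fun a b ↦ ?_⟩
  rw [intervalIntegral.integral_sub (intervalIntegrable_of_locallyIntegrable h₁.1 a b)
    (intervalIntegrable_of_locallyIntegrable h₂.1 a b), h₁.2, h₂.2]
  beta_reduce
  abel

end IsPrimitive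

end Primitive

/-! ### Weak derivatives on an interval. -/

theorem ae_eq_of_forall_testFunction_smul {L : ℝ} {u v : ℝ → E3}
    (hu : LocallyIntegrableOn u (Ioo 0 L) volume) (hv : LocallyIntegrableOn v (Ioo 0 L) volume)
    (h : ∀ φ : ℝ → ℝ, ContDiff ℝ ∞ φ → HasCompactSupport φ → tsupport φ ⊆ Ioo 0 L →
      ∫ s in Ioo 0 L, φ s • u s = ∫ s in Ioo 0 L, φ s • v s) :
    u =ᵐ[volume.restrict (Ioo 0 L)] v := by
  have hint : ∀ f : ℝ → E3, LocallyIntegrableOn f (Ioo 0 L) volume → ∀ φ : ℝ → ℝ,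
      ContDiff ℝ ∞ φ → HasCompactSupport φ → tsupport φ ⊆ Ioo 0 L →
      Integrable (fun s ↦ φ s • f s) volume := by
    intro f hf φ hφ hc hs
    have h1 : IntegrableOn (fun s ↦ φ s • f s) (tsupport φ) :=
      (hf.integrableOn_compact_subset hs hc).continuousOn_smul hφ.continuous.continuousOn hc
    refine h1.integrable_of_forall_notMem_eq_zero fun s hs ↦ ?_
    rw [image_eq_zero_of_notMem_tsupport hs, zero_smul]
  have := isOpen_Ioo.ae_eq_zero_of_integral_contDiff_smul_eq_zero (hu.sub hv) (by
    intro φ hφ hc hs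
    have e : ∀ f : ℝ → E3, ∫ s in Ioo 0 L, φ s • f s = ∫ s, φ s • f s := fun f ↦
      setIntegral_eq_integral_of_forall_compl_eq_zero fun s h' ↦ by
        rw [image_eq_zero_of_notMem_tsupport fun h'' ↦ h' (hs h''), zero_smul]
    have h2 := h φ hφ hc hs
    rw [e, e] at h2
    simp only [Pi.sub_apply, smul_sub]
    rw [integral_sub (hint u hu φ hφ hc hs) (hint v hv φ hφ hc hs), h2, sub_self])
  rw [EventuallyEq, ae_restrict_iff' measurableSet_Ioo]
  filter_upwards [this] with s hs h'
  exact sub_eq_zero.1 (hs h')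

theorem IsWeakDeriv.congr_left {L : ℝ} {u u' v : ℝ → E3} (h : IsWeakDeriv L u v)
    (hu : u =ᵐ[volume.restrict (Ioo 0 L)] u') : IsWeakDeriv L u' v := by
  obtain ⟨h1, h2, h3⟩ := h
  refine ⟨?_, h2, fun φ hφ hc hs ↦ ?_⟩
  · rw [locallyIntegrableOn_iff isOpen_Ioo.isLocallyClosed] at h1 ⊢
    intro k hk hkc
    exact (h1 k hk hkc).congr (ae_restrict_of_ae_restrict_of_subset hk hu)
  · rw [← h3 φ hφ hc hs]
    refine integral_congr_ae ?_
    filter_upwards [hu] with s hs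
    rw [hs]

theorem IsWeakDeriv.unique {L : ℝ} {u v v' : ℝ → E3} (h : IsWeakDeriv L u v)
    (h' : IsWeakDeriv L u v') : v =ᵐ[volume.restrict (Ioo 0 L)] v' := by
  refine ae_eq_of_forall_testFunction_smul h.2.1 h'.2.1 fun φ hφ hc hs ↦ ?_
  have h1 := h.2.2 φ hφ hc hs
  rw [h'.2.2 φ hφ hc hs, neg_inj] at h1
  exact h1.symm

/-- `weakDeriv` is an arbitrary choice; uniqueness almost everywhere is what makes it computable
from any known weak derivative. -/
theorem weakDeriv_ae_eq {L : ℝ} {u u' v : ℝ → E3} (h : IsWeakDeriv L u' v)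
    (hu : u =ᵐ[volume.restrict (Ioo 0 L)] u') :
    weakDeriv L u =ᵐ[volume.restrict (Ioo 0 L)] v := by
  have hv := h.congr_left hu.symm
  have hex : ∃ v, IsWeakDeriv L u v := ⟨v, hv⟩
  rw [weakDeriv, dif_pos hex]
  exact hex.choose_spec.unique hv

theorem IsPrimitive.isWeakDeriv {f g : ℝ → E3} (h : IsPrimitive f g) {L : ℝ} (hL : 0 < L) :
    IsWeakDeriv L f g := by
  refine ⟨h.continuous.locallyIntegrable.locallyIntegrableOn _, h.1.locallyIntegrableOn _,
    fun φ hφ hc hs ↦ ?_⟩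
  have hφ' : IsPrimitive φ (deriv φ) := IsPrimitive.of_hasDerivAt
    (hφ.continuous_deriv (by simp)) fun s ↦ (hφ.differentiable (by simp)).differentiableAt.hasDerivAt
  have hp := (hφ'.smul h).2 0 L
  have hz : ∀ s, s ∉ Ioo 0 L → φ s = 0 := fun s h' ↦
    image_eq_zero_of_notMem_tsupport fun h'' ↦ h' (hs h'')
  beta_reduce at hp
  rw [hz 0 (by simp), hz L (by simp), intervalIntegral.integral_add] at hp
  · simp only [intervalIntegral.integral_of_le hL.le, integral_Ioc_eq_integral_Ioo] at hp
    rw [zero_smul, zero_smul, sub_zero] at hp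
    exact eq_neg_of_add_eq_zero_left hp
  · exact ((hφ.continuous_deriv (by simp)).smul h.continuous).intervalIntegrable _ _
  · exact (intervalIntegrable_of_locallyIntegrable h.1 0 L).continuousOn_smul hφ.continuous.continuousOn

/-- The du Bois-Reymond argument: with a bump `η` of integral one, `ψ - (∫ ψ) η` has a compactly
supported primitive, which is an admissible test function. Hence `∫ ψ u = (∫ ψ) ∫ η u` for every
test function `ψ`. -/
theorem IsWeakDeriv.ae_eq_const {L : ℝ} (hL : 0 < L) {u : ℝ → E3} (h : IsWeakDeriv L u 0) :
    ∃ c : E3, u =ᵐ[volume.restrict (Ioo 0 L)] fun _ ↦ c := by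
  obtain ⟨η₀, hη₀⟩ : ∃ b : ContDiffBump (L / 2), b.rOut = L / 4 :=
    ⟨⟨L / 8, L / 4, by positivity, by linarith⟩, rfl⟩
  set η := η₀.normed volume with hη
  have hηs : tsupport η ⊆ Icc (L / 4) (3 * L / 4) := by
    rw [hη, η₀.tsupport_normed_eq, hη₀, Real.closedBall_eq_Icc]
    exact Icc_subset_Icc (by linarith) (by linarith)
  have hηc : ContDiff ℝ ∞ η := η₀.contDiff_normed
  refine ⟨∫ s in Ioo 0 L, η s • u s, ae_eq_of_forall_testFunction_smul h.1
    (continuous_const.locallyIntegrable.locallyIntegrableOn _) fun ψ hψ hc hs ↦ ?_⟩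
  set c := ∫ t, ψ t
  obtain ⟨a, b, ha, hab, hb, hsab⟩ : ∃ a b : ℝ, 0 < a ∧ a ≤ b ∧ b < L ∧
      ∀ s, s ∉ Icc a b → ψ s = 0 ∧ η s = 0 := by
    have hK : IsCompact (tsupport ψ ∪ Icc (L / 4) (3 * L / 4)) := hc.isCompact.union isCompact_Icc
    have hKs : tsupport ψ ∪ Icc (L / 4) (3 * L / 4) ⊆ Ioo 0 L :=
      union_subset hs (Icc_subset_Ioo (by linarith) (by linarith))
    have hKn : (tsupport ψ ∪ Icc (L / 4) (3 * L / 4)).Nonempty :=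
      ⟨L / 4, Or.inr ⟨le_rfl, by linarith⟩⟩
    obtain ⟨a, ha, ha'⟩ := hK.exists_isLeast hKn
    obtain ⟨b, hb, hb'⟩ := hK.exists_isGreatest hKn
    refine ⟨a, b, (hKs ha).1, ha' hb, (hKs hb).2, fun s hs' ↦ ⟨?_, ?_⟩⟩
    · exact image_eq_zero_of_notMem_tsupport fun h' ↦
        hs' ⟨ha' (Or.inl h'), hb' (Or.inl h')⟩
    · exact image_eq_zero_of_notMem_tsupport fun h' ↦
        hs' ⟨ha' (Or.inr (hηs h')), hb' (Or.inr (hηs h'))⟩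
  set φ : ℝ → ℝ := fun s ↦ ∫ t in (0 : ℝ)..s, (ψ t - c * η t)
  have hcont : Continuous fun t ↦ ψ t - c * η t :=
    hψ.continuous.sub (continuous_const.mul hηc.continuous)
  have hd : ∀ s, HasDerivAt φ (ψ s - c * η s) s := fun s ↦
    intervalIntegral.integral_hasDerivAt_right (hcont.intervalIntegrable _ _)
      (hcont.stronglyMeasurableAtFilter _ _) hcont.continuousAt
  have hderiv : deriv φ = fun s ↦ ψ s - c * η s := funext fun s ↦ (hd s).deriv
  have hsm : ContDiff ℝ ∞ φ := by
    rw [contDiff_infty_iff_deriv, hderiv]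
    exact ⟨fun s ↦ (hd s).differentiableAt, hψ.sub (contDiff_const.mul hηc)⟩
  -- To the right of `b` this uses that the integrand of `φ` has mean zero.
  have hz : ∀ s, s ∉ Icc a b → φ s = 0 := by
    intro s hs'
    rcases lt_or_ge s a with hsa | hsa
    · refine (intervalIntegral.integral_congr (g := fun _ ↦ (0 : ℝ)) fun t ht ↦ ?_).trans (by simp)
      have : t ∉ Icc a b := fun h' ↦ by
        have := (mem_uIcc.1 ht)
        rcases this with h'' | h'' <;> linarith [h'.1, h''.2]
      simp [hsab t this]
    · have hsb : b < s := not_le.1 fun h' ↦ hs' ⟨hsa, h'⟩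
      have e : ∀ f : ℝ → ℝ, (∀ t, t ∉ Icc a b → f t = 0) → ∫ t in (0 : ℝ)..s, f t = ∫ t, f t := by
        intro f hf
        rw [intervalIntegral.integral_of_le (by linarith)]
        exact setIntegral_eq_integral_of_forall_compl_eq_zero fun t ht ↦ hf t fun h' ↦
          ht ⟨by linarith [h'.1], by linarith [h'.2]⟩
      have hηi : ∫ t, η t = 1 := η₀.integral_normed
      change ∫ t in (0 : ℝ)..s, (ψ t - c * η t) = 0
      rw [intervalIntegral.integral_sub (hψ.continuous.intervalIntegrable _ _)
        ((hηc.continuous.const_mul c).intervalIntegrable _ _),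
        intervalIntegral.integral_const_mul, e ψ fun t ht ↦ (hsab t ht).1,
        e η fun t ht ↦ (hsab t ht).2, hηi, mul_one, sub_self]
  have hts : tsupport φ ⊆ Icc a b :=
    closure_minimal (fun s hs' ↦ by_contra fun h' ↦ hs' (hz s h')) isClosed_Icc
  have key := h.2.2 φ hsm (HasCompactSupport.intro isCompact_Icc hz)
    (hts.trans (Icc_subset_Ioo ha hb))
  rw [hderiv] at key
  have hint : ∀ f : ℝ → ℝ, Continuous f → (∀ t, t ∉ Icc a b → f t = 0) →
      IntegrableOn (fun s ↦ f s • u s) (Ioo 0 L) := by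
    intro f hf hz
    have h1 : IntegrableOn (fun s ↦ f s • u s) (Icc a b) :=
      (h.1.integrableOn_compact_subset (Icc_subset_Ioo ha hb) isCompact_Icc).continuousOn_smul
        hf.continuousOn isCompact_Icc
    exact (h1.integrable_of_forall_notMem_eq_zero fun s hs ↦ by
      rw [hz s hs, zero_smul]).integrableOn
  have h1 := hint ψ hψ.continuous fun t ht ↦ (hsab t ht).1
  have h2 : IntegrableOn (fun s ↦ c • η s • u s) (Ioo 0 L) :=
    (hint η hηc.continuous fun t ht ↦ (hsab t ht).2).smul c
  simp only [sub_smul, mul_smul, Pi.zero_apply, smul_zero, integral_zero, neg_zero] at key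
  rw [integral_sub h1 h2, integral_smul, sub_eq_zero] at key
  rw [key, integral_smul_const]
  congr 1
  refine (setIntegral_eq_integral_of_forall_compl_eq_zero fun t ht ↦ ?_).symm
  exact (hsab t fun h' ↦ ht (Icc_subset_Ioo ha hb h')).1

theorem IsWeakDeriv.sub {L : ℝ} {u v u' v' : ℝ → E3} (h : IsWeakDeriv L u v)
    (h' : IsWeakDeriv L u' v') : IsWeakDeriv L (u - u') (v - v') := by
  have hint : ∀ f : ℝ → E3, LocallyIntegrableOn f (Ioo 0 L) volume → ∀ φ : ℝ → ℝ,
      Continuous φ → HasCompactSupport φ → ∀ K, IsCompact K → K ⊆ Ioo 0 L →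
      (∀ s, s ∉ K → φ s = 0) → IntegrableOn (fun s ↦ φ s • f s) (Ioo 0 L) volume := by
    intro f hf φ hφ hc K hK hs hz
    have h1 : IntegrableOn (fun s ↦ φ s • f s) K :=
      (hf.integrableOn_compact_subset hs hK).continuousOn_smul hφ.continuousOn hK
    exact (h1.integrable_of_forall_notMem_eq_zero fun s hs ↦ by
      rw [hz s hs, zero_smul]).integrableOn
  refine ⟨h.1.sub h'.1, h.2.1.sub h'.2.1, fun φ hφ hc hs ↦ ?_⟩
  have hz : ∀ s, s ∉ tsupport φ → φ s = 0 := fun s ↦ image_eq_zero_of_notMem_tsupport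
  have hz' : ∀ s, s ∉ tsupport φ → deriv φ s = 0 := fun s h'' ↦
    image_eq_zero_of_notMem_tsupport fun h3 ↦ h'' (tsupport_deriv_subset h3)
  have hd : Continuous (deriv φ) := hφ.continuous_deriv (by simp)
  simp only [Pi.sub_apply, smul_sub]
  rw [integral_sub (hint u h.1 _ hd hc.deriv _ hc hs hz')
      (hint u' h'.1 _ hd hc.deriv _ hc hs hz'),
    integral_sub (hint v h.2.1 _ hφ.continuous hc _ hc hs hz)
      (hint v' h'.2.1 _ hφ.continuous hc _ hc hs hz), h.2.2 φ hφ hc hs, h'.2.2 φ hφ hc hs]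
  abel

/-- Used to integrate `γ''` twice, and again to obtain a continuous representative of the curvature.
-/
theorem IsWeakDeriv.exists_ae_eq_primitive {L : ℝ} (hL : 0 < L) {u v : ℝ → E3}
    (h : IsWeakDeriv L u v) {g f : ℝ → E3} (hg : v =ᵐ[volume.restrict (Ioo 0 L)] g)
    (hf : IsPrimitive f g) :
    ∃ c : E3, u =ᵐ[volume.restrict (Ioo 0 L)] fun s ↦ c + f s := by
  have h0 := h.sub (hf.isWeakDeriv hL)
  have hz : IsWeakDeriv L (u - f) 0 := by
    refine ⟨h0.1, locallyIntegrableOn_zero, fun φ hφ hc hs ↦ ?_⟩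
    rw [h0.2.2 φ hφ hc hs]
    congr 1
    refine integral_congr_ae ?_
    filter_upwards [hg] with s hs
    simp [hs]
  obtain ⟨c, hc⟩ := hz.ae_eq_const hL
  refine ⟨c, ?_⟩
  filter_upwards [hc] with s hs
  rw [← hs, Pi.sub_apply, sub_add_cancel]

/-! ### Clamped curves encoded by their curvature fields. -/

/-- The tangent field with initial value `V` and derivative `w`. -/
noncomputable def tangent (V : E3) (w : ℝ → E3) (s : ℝ) : E3 := V + ∫ t in (0 : ℝ)..s, w t

/-- `w` is the curvature vector field, extended by zero, of a clamped arclength parametrized curve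
with displacement `P` and end tangents `V₀`, `V₁`. -/
structure IsAdmissible (L : ℝ) (P V₀ V₁ : E3) (w : ℝ → E3) : Prop where
  memLp : MemLp w 2 volume
  eq_zero : ∀ s, s ∉ Ioo 0 L → w s = 0
  norm_tangent : ∀ s, ‖tangent V₀ w s‖ = 1
  tangent_end : tangent V₀ w L = V₁
  integral_tangent : ∫ s in (0 : ℝ)..L, tangent V₀ w s = P

/-- Local minimality of the energy `∫ ‖w‖²` among admissible curvature vector fields. -/
def IsLocalMinField (L : ℝ) (P V₀ V₁ : E3) (w : ℝ → E3) : Prop :=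
  ∃ δ > 0, ∀ w', IsAdmissible L P V₀ V₁ w' → ∫ s, ‖w' s - w s‖ ^ 2 < δ →
    ∫ s, ‖w s‖ ^ 2 ≤ ∫ s, ‖w' s‖ ^ 2

theorem integrable_of_memLp_two {L : ℝ} {w : ℝ → E3} (hw : MemLp w 2 volume)
    (hz : ∀ s, s ∉ Ioo 0 L → w s = 0) : Integrable w volume := by
  have : IntegrableOn w (Ioo 0 L) := (hw.restrict _).integrable one_le_two
  exact this.integrable_of_forall_notMem_eq_zero hz

theorem integrable_norm_sq {w : ℝ → E3} (hw : MemLp w 2 volume) :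
    Integrable (fun s ↦ ‖w s‖ ^ 2) volume := hw.integrable_norm_pow (by simp)

theorem isPrimitive_tangent {w : ℝ → E3} (hw : Integrable w volume) (V : E3) :
    IsPrimitive (tangent V w) w := isPrimitive_integral hw.locallyIntegrable V

theorem tangent_zero (V : E3) (w : ℝ → E3) : tangent V w 0 = V := by simp [tangent]

theorem tangent_of_le {L : ℝ} {w : ℝ → E3} (hz : ∀ s, s ∉ Ioo 0 L → w s = 0) (V : E3) {s : ℝ}
    (hs : s ≤ 0) : tangent V w s = V := by
  rw [tangent, intervalIntegral.integral_congr (g := fun _ ↦ 0), intervalIntegral.integral_zero,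
    add_zero]
  intro t ht
  rw [uIcc_of_ge hs] at ht
  exact hz t fun h ↦ absurd h.1 (not_lt.2 ht.2)

theorem tangent_of_ge {L : ℝ} {w : ℝ → E3} (hw : Integrable w volume)
    (hz : ∀ s, s ∉ Ioo 0 L → w s = 0) (V : E3) {s : ℝ}
    (hs : L ≤ s) : tangent V w s = tangent V w L := by
  rw [← sub_eq_zero, ← (isPrimitive_tangent hw V).2,
    intervalIntegral.integral_congr (g := fun _ ↦ 0), intervalIntegral.integral_zero]
  intro t ht
  rw [uIcc_of_le hs] at ht
  exact hz t fun h ↦ absurd h.2 (not_lt.2 ht.1)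

theorem hasDerivAt_integral_of_continuous {E : Type*} [NormedAddCommGroup E] [NormedSpace ℝ E]
    [CompleteSpace E] {f : ℝ → E} (hf : Continuous f) (c : E) (s : ℝ) :
    HasDerivAt (fun s ↦ c + ∫ t in (0 : ℝ)..s, f t) (f s) s :=
  (intervalIntegral.integral_hasDerivAt_right (hf.intervalIntegrable _ _)
    (hf.stronglyMeasurableAtFilter _ _) hf.continuousAt).const_add c

theorem derivIcc_eq {L : ℝ} (hL : 0 < L) {f g : ℝ → E3} {v : E3} {s : ℝ} (hs : s ∈ Icc 0 L)
    (hfg : EqOn f g (Icc 0 L)) (hg : HasDerivAt g v s) : derivIcc L f s = v := by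
  rw [derivIcc, derivWithin_congr hfg (hfg hs)]
  exact hg.hasDerivWithinAt.derivWithin (uniqueDiffOn_Icc hL s hs)

theorem exists_isAdmissible {L : ℝ} (hL : 0 < L) {P₀ P₁ V₀ V₁ : E3} {γ : ℝ → E3}
    (hγ : γ ∈ clampedCurves L P₀ P₁ V₀ V₁) :
    ∃ w, IsAdmissible L (P₁ - P₀) V₀ V₁ w ∧
      EqOn γ (fun s ↦ P₀ + ∫ t in (0 : ℝ)..s, tangent V₀ w t) (Icc 0 L) := by
  obtain ⟨⟨⟨-, v, w₀, hv, hw₀, -, hL2⟩, hC1, hunit⟩, h0, hL1, hd0, hdL⟩ := hγ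
  set w := indicator (Ioo 0 L) w₀ with hwdef
  have hz : ∀ s, s ∉ Ioo 0 L → w s = 0 := fun s hs ↦ indicator_of_notMem hs _
  have hwL : MemLp w 2 volume := (memLp_indicator_iff_restrict measurableSet_Ioo).2 hL2
  have hwi := integrable_of_memLp_two hwL hz
  have hww : w₀ =ᵐ[volume.restrict (Ioo 0 L)] w := by
    filter_upwards [ae_restrict_mem measurableSet_Ioo] with s hs
    rw [hwdef, indicator_of_mem hs]
  obtain ⟨c, hc⟩ := hw₀.exists_ae_eq_primitive hL hww (isPrimitive_tangent hwi 0)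
  have htan : ∀ V s, tangent V w s = V + tangent 0 w s := fun V s ↦ by simp [tangent]
  have hc' : v =ᵐ[volume.restrict (Ioo 0 L)] tangent c w := by
    filter_upwards [hc] with s hs
    rw [hs, htan c]
  have hcont := (isPrimitive_tangent hwi c).continuous
  obtain ⟨d, hd⟩ := hv.exists_ae_eq_primitive hL hc'
    (isPrimitive_integral hcont.locallyIntegrable 0)
  have hder : ∀ d s, HasDerivAt (fun s ↦ d + ∫ t in (0 : ℝ)..s, tangent c w t) (tangent c w s) s :=
    fun d s ↦ hasDerivAt_integral_of_continuous hcont d s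
  have heq : EqOn γ (fun s ↦ d + ∫ t in (0 : ℝ)..s, tangent c w t) (Icc 0 L) := by
    refine Measure.eqOn_Icc_of_ae_eq volume hL.ne ?_ hC1.continuousOn
      fun s _ ↦ (hder d s).continuousAt.continuousWithinAt
    rw [← restrict_Ioo_eq_restrict_Icc]
    filter_upwards [hd] with s hs
    rw [hs, zero_add]
  have hdγ : ∀ s ∈ Icc 0 L, derivIcc L γ s = tangent c w s := fun s hs ↦
    derivIcc_eq hL hs heq (hder d s)
  have hm0 : (0 : ℝ) ∈ Icc 0 L := ⟨le_rfl, hL.le⟩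
  have hmL : L ∈ Icc 0 L := ⟨hL.le, le_rfl⟩
  -- The two constants of integration are identified by the clamped conditions at `0`.
  have hcV : c = V₀ := by rw [← hd0, hdγ 0 hm0, tangent_zero]
  have hdP : d = P₀ := by rw [← h0, heq hm0]; simp
  subst hcV hdP
  refine ⟨w, ⟨hwL, hz, fun s ↦ ?_, ?_, ?_⟩, heq⟩
  · rcases le_total s 0 with h | h
    · rw [tangent_of_le hz _ h, ← tangent_zero c w, ← hdγ 0 hm0, hunit 0 hm0]
    rcases le_total L s with h' | h'
    · rw [tangent_of_ge hwi hz _ h', ← hdγ L hmL, hunit L hmL]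
    · rw [← hdγ s ⟨h, h'⟩, hunit s ⟨h, h'⟩]
  · rw [← hdγ L hmL, hdL]
  · rw [← hL1, heq hmL, add_sub_cancel_left]

theorem setIntegral_norm_sq_eq {L : ℝ} {w : ℝ → E3} (hz : ∀ s, s ∉ Ioo 0 L → w s = 0) :
    ∫ s in Ioo 0 L, ‖w s‖ ^ 2 = ∫ s, ‖w s‖ ^ 2 :=
  setIntegral_eq_integral_of_forall_compl_eq_zero fun s hs ↦ by rw [hz s hs]; simp

theorem weakDeriv_ae_eq_of_isPrimitive {L : ℝ} (hL : 0 < L) {u f T w : ℝ → E3}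
    (hu : EqOn u f (Icc 0 L)) (hf : IsPrimitive f T) (hT : IsPrimitive T w) :
    weakDeriv L u =ᵐ[volume.restrict (Ioo 0 L)] T ∧
      weakDeriv L (weakDeriv L u) =ᵐ[volume.restrict (Ioo 0 L)] w := by
  have h1 : weakDeriv L u =ᵐ[volume.restrict (Ioo 0 L)] T := by
    refine weakDeriv_ae_eq (hf.isWeakDeriv hL) ?_
    filter_upwards [ae_restrict_mem measurableSet_Ioo] with s hs
    exact hu (Ioo_subset_Icc_self hs)
  exact ⟨h1, weakDeriv_ae_eq (hT.isWeakDeriv hL) h1⟩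

theorem bendingEnergy_eq {L : ℝ} (hL : 0 < L) {P V : E3} {w γ : ℝ → E3}
    (hw : Integrable w volume) (hz : ∀ s, s ∉ Ioo 0 L → w s = 0)
    (hγ : EqOn γ (fun s ↦ P + ∫ t in (0 : ℝ)..s, tangent V w t) (Icc 0 L)) :
    bendingEnergy L γ = ∫ s, ‖w s‖ ^ 2 := by
  have hT := isPrimitive_tangent hw V
  rw [bendingEnergy, ← setIntegral_norm_sq_eq hz]
  refine integral_congr_ae ?_
  filter_upwards [(weakDeriv_ae_eq_of_isPrimitive hL hγ
    (isPrimitive_integral hT.continuous.locallyIntegrable P) hT).2] with s hs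
  rw [hs]

theorem memLp_of_continuous {L : ℝ} {f : ℝ → E3} (hf : Continuous f) :
    MemLp f 2 (volume.restrict (Ioo 0 L)) := by
  obtain ⟨C, hC⟩ := (isCompact_Icc (a := 0) (b := L)).exists_bound_of_continuousOn hf.continuousOn
  refine MemLp.of_bound hf.aestronglyMeasurable C ?_
  filter_upwards [ae_restrict_mem measurableSet_Ioo] with s hs
  exact hC s (Ioo_subset_Icc_self hs)

theorem mem_clampedCurves {L : ℝ} (hL : 0 < L) {P₀ P₁ V₀ V₁ : E3} {w : ℝ → E3}
    (hw : IsAdmissible L (P₁ - P₀) V₀ V₁ w) :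
    (fun s ↦ P₀ + ∫ t in (0 : ℝ)..s, tangent V₀ w t) ∈ clampedCurves L P₀ P₁ V₀ V₁ := by
  have hwi := integrable_of_memLp_two hw.memLp hw.eq_zero
  have hT := isPrimitive_tangent hwi V₀
  have hξ := isPrimitive_integral hT.continuous.locallyIntegrable P₀
  have hder := hasDerivAt_integral_of_continuous hT.continuous P₀
  have hdI : ∀ s ∈ Icc 0 L, derivIcc L (fun s ↦ P₀ + ∫ t in (0 : ℝ)..s, tangent V₀ w t) s =
      tangent V₀ w s := fun s hs ↦ derivIcc_eq hL hs (eqOn_refl _ _) (hder s)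
  refine ⟨⟨⟨memLp_of_continuous hξ.continuous, _, w, hξ.isWeakDeriv hL, hT.isWeakDeriv hL,
    memLp_of_continuous hT.continuous, hw.memLp.restrict _⟩, ?_, fun s hs ↦ ?_⟩, ?_, ?_, ?_, ?_⟩
  · refine ContDiff.contDiffOn ?_
    rw [contDiff_one_iff_deriv]
    refine ⟨fun s ↦ (hder s).differentiableAt, ?_⟩
    rw [funext fun s ↦ (hder s).deriv]
    exact hT.continuous
  · rw [hdI s hs, hw.norm_tangent]
  · simp
  · beta_reduce
    rw [hw.integral_tangent, add_sub_cancel]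
  · rw [hdI 0 ⟨le_rfl, hL.le⟩, tangent_zero]
  · rw [hdI L ⟨hL.le, le_rfl⟩, hw.tangent_end]

/-- Young's inequality `‖g‖ ≤ ε / 2 + ‖g‖² / (2ε)` takes the place of Cauchy–Schwarz. -/
theorem norm_integral_le_of_integral_norm_sq_lt {L ε : ℝ} (hL : 0 < L) (hε : 0 < ε) {g : ℝ → E3}
    (hg : MemLp g 2 volume) (hz : ∀ s, s ∉ Ioo 0 L → g s = 0)
    (h : ∫ s, ‖g s‖ ^ 2 < ε ^ 2) {s : ℝ} (hs : s ∈ Icc 0 L) :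
    ‖∫ t in (0 : ℝ)..s, g t‖ ≤ ε * (L + 1) / 2 := by
  have hi := integrable_of_memLp_two hg hz
  have h2 : IntegrableOn (fun s ↦ ‖g s‖ ^ 2) (Ioc 0 L) := (integrable_norm_sq hg).integrableOn
  calc ‖∫ t in (0 : ℝ)..s, g t‖ ≤ ∫ t in (0 : ℝ)..s, ‖g t‖ :=
        intervalIntegral.norm_integral_le_integral_norm hs.1
    _ = ∫ t in Ioc 0 s, ‖g t‖ := intervalIntegral.integral_of_le hs.1
    _ ≤ ∫ t in Ioc 0 L, ‖g t‖ := setIntegral_mono_set hi.norm.integrableOn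
        (ae_of_all _ fun _ ↦ norm_nonneg _) (Ioc_subset_Ioc_right hs.2).eventuallyLE
    _ ≤ ∫ t in Ioc 0 L, (ε / 2 + (2 * ε)⁻¹ * ‖g t‖ ^ 2) := by
        refine setIntegral_mono hi.norm.integrableOn
          ((integrable_const _).add (h2.const_mul _)) fun t ↦ ?_
        beta_reduce
        have : ε / 2 + (2 * ε)⁻¹ * ‖g t‖ ^ 2 - ‖g t‖ = (2 * ε)⁻¹ * (‖g t‖ - ε) ^ 2 := by
          field_simp
          ring
        nlinarith [show 0 ≤ (2 * ε)⁻¹ * (‖g t‖ - ε) ^ 2 by positivity]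
    _ = L * (ε / 2) + (2 * ε)⁻¹ * ∫ s, ‖g s‖ ^ 2 := by
        rw [integral_add (integrable_const _) (h2.const_mul _), integral_const_mul,
          integral_Ioc_eq_integral_Ioo, integral_Ioc_eq_integral_Ioo, setIntegral_norm_sq_eq hz]
        simp [hL.le]
    _ ≤ L * (ε / 2) + (2 * ε)⁻¹ * ε ^ 2 := by gcongr
    _ = ε * (L + 1) / 2 := by field_simp

/-- Both curves have the same initial point and tangent, so the two lower order terms are controlled
by integrating the difference of the curvature fields once and twice. -/
theorem normW22_le {L ε : ℝ} (hL : 0 < L) (hε : 0 < ε) {P V : E3} {w w' γ : ℝ → E3}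
    (hw : MemLp w 2 volume) (hw' : MemLp w' 2 volume)
    (hz : ∀ s, s ∉ Ioo 0 L → w s = 0) (hz' : ∀ s, s ∉ Ioo 0 L → w' s = 0)
    (hγ : EqOn γ (fun s ↦ P + ∫ t in (0 : ℝ)..s, tangent V w t) (Icc 0 L))
    (h : ∫ s, ‖w' s - w s‖ ^ 2 < ε ^ 2) :
    normW22 L ((fun s ↦ P + ∫ t in (0 : ℝ)..s, tangent V w' t) - γ) ≤
      ε * Real.sqrt ((L * ((L + 1) / 2)) ^ 2 * L + ((L + 1) / 2) ^ 2 * L + 1) := by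
  have hi := integrable_of_memLp_two hw hz
  have hi' := integrable_of_memLp_two hw' hz'
  have hT := isPrimitive_tangent hi V
  have hT' := isPrimitive_tangent hi' V
  have hξ := isPrimitive_integral hT.continuous.locallyIntegrable P
  have hξ' := isPrimitive_integral hT'.continuous.locallyIntegrable P
  have hdiff : EqOn ((fun s ↦ P + ∫ t in (0 : ℝ)..s, tangent V w' t) - γ)
      (fun s ↦ (P + ∫ t in (0 : ℝ)..s, tangent V w' t) -
        (P + ∫ t in (0 : ℝ)..s, tangent V w t)) (Icc 0 L) := fun s hs ↦ by
    rw [Pi.sub_apply, hγ hs]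
  obtain ⟨h1, h2⟩ := weakDeriv_ae_eq_of_isPrimitive hL hdiff (hξ'.sub hξ) (hT'.sub hT)
  have hTb : ∀ s ∈ Icc 0 L, ‖tangent V w' s - tangent V w s‖ ≤ ε * (L + 1) / 2 := by
    intro s hs
    have := norm_integral_le_of_integral_norm_sq_lt hL hε (hw'.sub hw)
      (fun s hs ↦ by simp [hz s hs, hz' s hs]) h hs
    simp only [Pi.sub_apply] at this
    rwa [intervalIntegral.integral_sub hi'.intervalIntegrable hi.intervalIntegrable,
      ← add_sub_add_left_eq_sub _ _ V] at this
  have hξb : ∀ s ∈ Icc 0 L, ‖(P + ∫ t in (0 : ℝ)..s, tangent V w' t) -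
        (P + ∫ t in (0 : ℝ)..s, tangent V w t)‖ ≤ ε * (L * ((L + 1) / 2)) := by
    intro s hs
    rw [add_sub_add_left_eq_sub, ← intervalIntegral.integral_sub
      (hT'.continuous.intervalIntegrable _ _) (hT.continuous.intervalIntegrable _ _)]
    refine (intervalIntegral.norm_integral_le_of_norm_le_const (C := ε * (L + 1) / 2)
      fun t ht ↦ hTb t ?_).trans ?_
    · rw [uIoc_of_le hs.1] at ht
      exact ⟨ht.1.le, ht.2.trans hs.2⟩
    · rw [sub_zero, abs_of_nonneg hs.1]
      have : ε * (L + 1) / 2 * s ≤ ε * (L + 1) / 2 * L := by gcongr; exact hs.2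
      linarith
  have hb : ∀ (f : ℝ → E3) (C : ℝ), (∀ᵐ s ∂volume.restrict (Ioo 0 L), ‖f s‖ ≤ ε * C) →
      ∫ s in Ioo 0 L, ‖f s‖ ^ 2 ≤ ε ^ 2 * (C ^ 2 * L) := by
    intro f C hf
    have := norm_setIntegral_le_of_norm_le_const_ae (μ := volume) (s := Ioo 0 L)
      (f := fun s ↦ ‖f s‖ ^ 2) (C := (ε * C) ^ 2) (by simp) (by
        filter_upwards [hf] with s hs
        rw [norm_pow, norm_norm]
        gcongr)
    refine (le_abs_self _).trans (this.trans (le_of_eq ?_))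
    simp [Measure.real, hL.le]
    ring
  rw [normW22]
  refine Real.sqrt_le_iff.2 ⟨by positivity, ?_⟩
  rw [mul_pow, Real.sq_sqrt (by positivity), mul_add, mul_add]
  refine add_le_add (add_le_add (hb _ _ ?_) (hb _ _ ?_)) ?_
  · filter_upwards [ae_restrict_mem measurableSet_Ioo] with s hs
    rw [hdiff (Ioo_subset_Icc_self hs)]
    exact hξb s (Ioo_subset_Icc_self hs)
  · filter_upwards [ae_restrict_mem measurableSet_Ioo, h1] with s hs h1s
    rw [h1s]
    exact (hTb s (Ioo_subset_Icc_self hs)).trans (le_of_eq (by ring))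
  · rw [mul_one]
    refine le_trans (le_of_eq ?_) h.le
    rw [← setIntegral_norm_sq_eq (L := L) (w := fun s ↦ w' s - w s)
      fun s hs ↦ by simp [hz s hs, hz' s hs]]
    refine integral_congr_ae ?_
    filter_upwards [h2] with s hs
    rw [hs]

theorem isLocalMinField_of_isLocalMinimizer {L : ℝ} (hL : 0 < L) {P₀ P₁ V₀ V₁ : E3} {γ w : ℝ → E3}
    (hγ : IsLocalMinimizer L (clampedCurves L P₀ P₁ V₀ V₁) γ)
    (hw : IsAdmissible L (P₁ - P₀) V₀ V₁ w)
    (h : EqOn γ (fun s ↦ P₀ + ∫ t in (0 : ℝ)..s, tangent V₀ w t) (Icc 0 L)) :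
    IsLocalMinField L (P₁ - P₀) V₀ V₁ w := by
  obtain ⟨-, δ, hδ, hmin⟩ := hγ
  set C := Real.sqrt ((L * ((L + 1) / 2)) ^ 2 * L + ((L + 1) / 2) ^ 2 * L + 1) with hC
  have hC0 : 0 < C := Real.sqrt_pos.2 (by positivity)
  have hε : 0 < δ / (2 * C) := by positivity
  refine ⟨(δ / (2 * C)) ^ 2, by positivity, fun w' hw' hlt ↦ ?_⟩
  have := hmin _ (mem_clampedCurves hL hw') ((normW22_le hL hε hw.memLp hw'.memLp hw.eq_zero
    hw'.eq_zero h hlt).trans_lt ?_)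
  · rwa [bendingEnergy_eq hL (integrable_of_memLp_two hw.memLp hw.eq_zero) hw.eq_zero h,
      bendingEnergy_eq hL (integrable_of_memLp_two hw'.memLp hw'.eq_zero) hw'.eq_zero
        (eqOn_refl _ _)] at this
  · rw [← hC]
    field_simp
    linarith

/-! ### Radial projection to the sphere and the resulting energy density. -/

section Normalization

variable {F : Type*} [NormedAddCommGroup F] [InnerProductSpace ℝ F]

/-- Radial projection to the unit sphere. -/
noncomputable def radial (X : F) : F := ‖X‖⁻¹ • X

/-- The derivative of the radial projection. -/
noncomputable def radialDeriv (X : F) : F →L[ℝ] F :=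
  ‖X‖⁻¹ • ContinuousLinearMap.id ℝ F - (‖X‖⁻¹ ^ 3) • (innerSL ℝ X).smulRight X

theorem radialDeriv_apply (X Y : F) :
    radialDeriv X Y = ‖X‖⁻¹ • Y - (‖X‖⁻¹ ^ 3 * ⟪X, Y⟫) • X := by
  simp [radialDeriv, mul_smul]

theorem norm_radial {X : F} (hX : X ≠ 0) : ‖radial X‖ = 1 := by
  rw [radial, norm_smul, norm_inv, norm_norm, inv_mul_cancel₀ (norm_ne_zero_iff.2 hX)]

theorem radial_of_norm_eq_one {X : F} (hX : ‖X‖ = 1) : radial X = X := by simp [radial, hX]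

theorem hasFDerivAt_radial {X : F} (hX : X ≠ 0) : HasFDerivAt radial (radialDeriv X) X := by
  have hn : 0 < ‖X‖ := norm_pos_iff.2 hX
  have h1 : HasFDerivAt (fun Y : F ↦ ‖Y‖ ^ 2) (2 • innerSL ℝ X) X :=
    (hasStrictFDerivAt_norm_sq X).hasFDerivAt
  have h2 : HasFDerivAt (fun Y : F ↦ ‖Y‖) (‖X‖⁻¹ • innerSL ℝ X) X := by
    have := h1.sqrt (by positivity)
    simp only [Real.sqrt_sq (norm_nonneg _)] at this
    refine this.congr_fderiv ?_
    ext Y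
    simp
    field_simp
  have h3 := ((hasDerivAt_inv hn.ne').comp_hasFDerivAt X h2).smul (hasFDerivAt_id X)
  refine h3.congr_fderiv ?_
  ext1 Y
  rw [radialDeriv_apply]
  simp [sub_eq_add_neg, smul_smul]
  congr 2
  field_simp

theorem contDiffAt_radial {X : F} (hX : X ≠ 0) : ContDiffAt ℝ 1 radial X :=
  ((contDiffAt_norm ℝ hX).inv (norm_ne_zero_iff.2 hX)).smul contDiffAt_id

/-- The squared norm of `radialDeriv X Y`, as a function of the pair `(X, Y)`. -/
noncomputable def density (p : F × F) : ℝ :=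
  ‖p.2‖ ^ 2 / ‖p.1‖ ^ 2 - (⟪p.1, p.2⟫ / ‖p.1‖ ^ 2) ^ 2

/-- Pythagoras: `radialDeriv X` is `‖X‖⁻¹` times the orthogonal projection onto the complement of
`X`. -/
theorem norm_radialDeriv_sq {X : F} (hX : X ≠ 0) (Y : F) :
    ‖radialDeriv X Y‖ ^ 2 = density (X, Y) := by
  have hn : ‖X‖ ≠ 0 := norm_ne_zero_iff.2 hX
  rw [radialDeriv_apply, norm_sub_sq_real, norm_smul, norm_smul, inner_smul_left, inner_smul_right,
    real_inner_comm X Y, density]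
  simp only [norm_inv, Real.norm_eq_abs, abs_norm, mul_pow, sq_abs, conj_trivial]
  field_simp
  ring

theorem norm_radialDeriv_le {X : F} (hX : X ≠ 0) (Y : F) : ‖radialDeriv X Y‖ ≤ ‖X‖⁻¹ * ‖Y‖ := by
  refine le_of_sq_le_sq ?_ (by positivity)
  rw [norm_radialDeriv_sq hX, density, mul_pow, inv_pow, div_eq_inv_mul]
  exact sub_le_self _ (sq_nonneg _)

theorem contDiffAt_density {p : F × F} (hp : p.1 ≠ 0) : ContDiffAt ℝ 1 density p := by
  have hn : ‖p.1‖ ^ 2 ≠ 0 := pow_ne_zero _ (norm_ne_zero_iff.2 hp)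
  have h1 : ContDiffAt ℝ 1 (fun p : F × F ↦ ‖p.1‖ ^ 2) p := contDiffAt_fst.norm_sq ℝ
  have h2 : ContDiffAt ℝ 1 (fun p : F × F ↦ ‖p.2‖ ^ 2) p := contDiffAt_snd.norm_sq ℝ
  exact (h2.div h1 hn).sub (((contDiffAt_fst.inner ℝ contDiffAt_snd).div h1 hn).pow 2)

theorem fderiv_density_apply {X : F} (hX : X ≠ 0) (Y u v : F) :
    fderiv ℝ density (X, Y) (u, v) = 2 * ⟪Y, v⟫ / ‖X‖ ^ 2 - 2 * ‖Y‖ ^ 2 * ⟪X, u⟫ / ‖X‖ ^ 4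
      - 2 * ⟪X, Y⟫ * (⟪X, v⟫ + ⟪u, Y⟫) / ‖X‖ ^ 4 + 4 * ⟪X, Y⟫ ^ 2 * ⟪X, u⟫ / ‖X‖ ^ 6 := by
  have hn : ‖X‖ ≠ 0 := norm_ne_zero_iff.2 hX
  have hl : HasDerivAt (fun t : ℝ ↦ density (X + t • u, Y + t • v))
      (fderiv ℝ density (X, Y) (u, v)) 0 := by
    have h := ((contDiffAt_density (p := (X, Y)) hX).differentiableAt (by simp)).hasFDerivAt
    have hline : HasDerivAt (fun t : ℝ ↦ (X + t • u, Y + t • v)) (u, v) 0 := by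
      have := (((hasDerivAt_id (0 : ℝ)).smul_const u).const_add X).prodMk
        (((hasDerivAt_id (0 : ℝ)).smul_const v).const_add Y)
      simpa using this
    exact HasFDerivAt.comp_hasDerivAt (0 : ℝ) (by simpa using h) hline
  have hX' : HasDerivAt (fun t : ℝ ↦ X + t • u) u 0 := by
    simpa using ((hasDerivAt_id (0 : ℝ)).smul_const u).const_add X
  have hY' : HasDerivAt (fun t : ℝ ↦ Y + t • v) v 0 := by
    simpa using ((hasDerivAt_id (0 : ℝ)).smul_const v).const_add Y
  have hn' : ‖X + (0 : ℝ) • u‖ ^ 2 ≠ 0 := by simpa using hX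
  have h := (hY'.norm_sq.div hX'.norm_sq hn').sub
    (((hX'.inner ℝ hY').div hX'.norm_sq hn').pow 2)
  rw [hl.unique h]
  simp
  field_simp
  ring

/-- Quadratic growth in `Y` suffices for domination, since `Y` will be a bounded perturbation of the
square integrable field `w`. -/
theorem norm_fderiv_density_le {X : F} (h : 1 / 2 ≤ ‖X‖) (Y : F) :
    ‖fderiv ℝ density (X, Y)‖ ≤ 64 * (1 + ‖Y‖) ^ 2 := by
  have hn : 0 < ‖X‖ := by linarith
  refine ContinuousLinearMap.opNorm_le_bound _ (by positivity) fun ⟨u, v⟩ ↦ ?_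
  rw [fderiv_density_apply (norm_pos_iff.1 hn)]
  set D := ‖(u, v)‖
  have hu : ‖u‖ ≤ D := norm_fst_le (u, v)
  have hv : ‖v‖ ≤ D := norm_snd_le (u, v)
  have hD : 0 ≤ D := norm_nonneg _
  set n := ‖X‖
  set m := ‖Y‖
  have hm : 0 ≤ m := norm_nonneg _
  have hXu : |⟪X, u⟫| ≤ n * D := (abs_real_inner_le_norm _ _).trans (by gcongr)
  have hXv : |⟪X, v⟫| ≤ n * D := (abs_real_inner_le_norm _ _).trans (by gcongr)
  have hYv : |⟪Y, v⟫| ≤ m * D := (abs_real_inner_le_norm _ _).trans (by gcongr)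
  have huY : |⟪u, Y⟫| ≤ D * m := (abs_real_inner_le_norm _ _).trans (by gcongr)
  have hXY : |⟪X, Y⟫| ≤ n * m := abs_real_inner_le_norm _ _
  have i1 : n⁻¹ ≤ 2 := by
    rw [inv_le_comm₀ hn two_pos]; linarith
  have i0 : 0 ≤ n⁻¹ := by positivity
  have i2 : n⁻¹ ^ 2 ≤ 4 := by nlinarith
  have i3 : n⁻¹ ^ 3 ≤ 8 := by nlinarith [sq_nonneg n⁻¹]
  have t1 : |2 * ⟪Y, v⟫ / n ^ 2| ≤ 8 * (m * D) := by
    rw [abs_div, abs_mul, abs_two, abs_of_pos (by positivity : 0 < n ^ 2)]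
    calc 2 * |⟪Y, v⟫| / n ^ 2 ≤ 2 * (m * D) / n ^ 2 := by gcongr
      _ = 2 * (m * D) * n⁻¹ ^ 2 := by field_simp
      _ ≤ 2 * (m * D) * 4 := by gcongr
      _ = _ := by ring
  have t2 : |2 * m ^ 2 * ⟪X, u⟫ / n ^ 4| ≤ 16 * (m ^ 2 * D) := by
    rw [abs_div, abs_mul, abs_of_nonneg (by positivity : 0 ≤ 2 * m ^ 2),
      abs_of_pos (by positivity : 0 < n ^ 4)]
    calc 2 * m ^ 2 * |⟪X, u⟫| / n ^ 4 ≤ 2 * m ^ 2 * (n * D) / n ^ 4 := by gcongr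
      _ = 2 * m ^ 2 * D * n⁻¹ ^ 3 := by field_simp
      _ ≤ 2 * m ^ 2 * D * 8 := by gcongr
      _ = _ := by ring
  have t3 : |2 * ⟪X, Y⟫ * (⟪X, v⟫ + ⟪u, Y⟫) / n ^ 4| ≤ 8 * (m * D) + 16 * (m ^ 2 * D) := by
    rw [abs_div, abs_mul, abs_mul, abs_two, abs_of_pos (by positivity : 0 < n ^ 4)]
    calc 2 * |⟪X, Y⟫| * |⟪X, v⟫ + ⟪u, Y⟫| / n ^ 4
        ≤ 2 * (n * m) * (n * D + D * m) / n ^ 4 := by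
          gcongr
          exact (abs_add_le _ _).trans (add_le_add hXv huY)
      _ = 2 * (m * D) * n⁻¹ ^ 2 + 2 * (m ^ 2 * D) * n⁻¹ ^ 3 := by field_simp
      _ ≤ 2 * (m * D) * 4 + 2 * (m ^ 2 * D) * 8 := by gcongr
      _ = _ := by ring
  have t4 : |4 * ⟪X, Y⟫ ^ 2 * ⟪X, u⟫ / n ^ 6| ≤ 32 * (m ^ 2 * D) := by
    rw [abs_div, abs_mul, abs_mul, abs_pow, abs_of_pos (by norm_num : (0 : ℝ) < 4),
      abs_of_pos (by positivity : 0 < n ^ 6)]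
    calc 4 * |⟪X, Y⟫| ^ 2 * |⟪X, u⟫| / n ^ 6 ≤ 4 * (n * m) ^ 2 * (n * D) / n ^ 6 := by gcongr
      _ = 4 * (m ^ 2 * D) * n⁻¹ ^ 3 := by field_simp
      _ ≤ 4 * (m ^ 2 * D) * 8 := by gcongr
      _ = _ := by ring
  rw [Real.norm_eq_abs]
  have := abs_add_le (2 * ⟪Y, v⟫ / n ^ 2 - 2 * m ^ 2 * ⟪X, u⟫ / n ^ 4
    - 2 * ⟪X, Y⟫ * (⟪X, v⟫ + ⟪u, Y⟫) / n ^ 4) (4 * ⟪X, Y⟫ ^ 2 * ⟪X, u⟫ / n ^ 6)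
  have := abs_sub (2 * ⟪Y, v⟫ / n ^ 2 - 2 * m ^ 2 * ⟪X, u⟫ / n ^ 4)
    (2 * ⟪X, Y⟫ * (⟪X, v⟫ + ⟪u, Y⟫) / n ^ 4)
  have := abs_sub (2 * ⟪Y, v⟫ / n ^ 2) (2 * m ^ 2 * ⟪X, u⟫ / n ^ 4)
  have : 0 ≤ m * D := by positivity
  nlinarith

theorem norm_radial_sub_le {X Y : F} (hX : 1 / 2 ≤ ‖X‖) (hY : 1 / 2 ≤ ‖Y‖) :
    ‖radial X - radial Y‖ ≤ 4 * ‖X - Y‖ := by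
  have hx : 0 < ‖X‖ := by linarith
  have hy : 0 < ‖Y‖ := by linarith
  have e : radial X - radial Y = ‖X‖⁻¹ • (X - Y) + (‖X‖⁻¹ * (‖Y‖ - ‖X‖) * ‖Y‖⁻¹) • Y := by
    have : ‖X‖⁻¹ * (‖Y‖ - ‖X‖) * ‖Y‖⁻¹ = ‖X‖⁻¹ - ‖Y‖⁻¹ := by field_simp
    rw [this, radial, radial, smul_sub, sub_smul]
    abel
  have i1 : ‖X‖⁻¹ ≤ 2 := by
    rw [inv_le_comm₀ hx two_pos]; linarith
  rw [e]
  refine (norm_add_le _ _).trans ?_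
  rw [norm_smul, norm_smul, norm_mul, norm_mul, norm_inv, norm_inv, norm_norm, norm_norm,
    Real.norm_eq_abs, inv_mul_cancel_right₀ hy.ne']
  have := abs_norm_sub_norm_le Y X
  rw [norm_sub_rev] at this
  calc ‖X‖⁻¹ * ‖X - Y‖ + ‖X‖⁻¹ * |‖Y‖ - ‖X‖| ≤ 2 * ‖X - Y‖ + 2 * ‖X - Y‖ := by gcongr
    _ = 4 * ‖X - Y‖ := by ring

/-- Away from the origin the projection is Lipschitz, so it preserves absolute continuity; the chain
rule then holds almost everywhere. -/
theorem IsPrimitive.radial [CompleteSpace F] {X Y : ℝ → F} (h : IsPrimitive X Y)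
    (hX : ∀ s, 1 / 2 ≤ ‖X s‖) :
    IsPrimitive (fun s ↦ Elastica.radial (X s)) (fun s ↦ radialDeriv (X s) (Y s)) := by
  have hpos : ∀ s, 0 < ‖X s‖ := fun s ↦ by linarith [hX s]
  have hne : ∀ s, X s ≠ 0 := fun s ↦ norm_pos_iff.1 (hpos s)
  refine of_absolutelyContinuous ?_ (fun a b ↦ absolutelyContinuousOnInterval_of_dist_le
    (h.absolutelyContinuous a b) 4 fun x y ↦ ?_) ?_
  · have hc : Continuous fun s ↦ ‖X s‖⁻¹ :=
      h.continuous.norm.inv₀ fun s ↦ (hpos s).ne'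
    refine LocallyIntegrable.mono (h.1.smul (2 : ℝ)) ?_ (ae_of_all _ fun s ↦ ?_)
    · simp only [radialDeriv_apply]
      have hm := h.1.aestronglyMeasurable
      exact (hc.aestronglyMeasurable.smul hm).sub
        (((hc.pow 3).aestronglyMeasurable.mul
          (h.continuous.aestronglyMeasurable.inner hm)).smul h.continuous.aestronglyMeasurable)
    · refine (norm_radialDeriv_le (hne s) _).trans ?_
      rw [Pi.smul_apply, norm_smul, Real.norm_ofNat]
      gcongr
      rw [inv_le_comm₀ (hpos s) two_pos]; linarith [hX s]
  · rw [dist_eq_norm, dist_eq_norm]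
    exact norm_radial_sub_le (hX x) (hX y)
  · filter_upwards [h.ae_hasDerivAt] with s hs
    exact (hasFDerivAt_radial (hne s)).comp_hasDerivAt s hs

end Normalization

/-- Dominated convergence gives a derivative at every point of the ball and its continuity at `0`,
and the two together give strict differentiability. The Lagrange multiplier theorem needs the strict
form. -/
theorem hasStrictFDerivAt_integral_comp_affine {α H F G : Type*} [MeasurableSpace α]
    {μ : Measure α} [NormedAddCommGroup H] [NormedSpace ℝ H]
    [NormedAddCommGroup F] [NormedSpace ℝ F] [FiniteDimensional ℝ F] [NormedAddCommGroup G]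
    [NormedSpace ℝ G] [FiniteDimensional ℝ G] [FiniteDimensional ℝ H]
    {g : F → G} {p : α → F} {Φ : α → H →L[ℝ] F} {bound : α → ℝ} {r : ℝ} (hr : 0 < r)
    (hp : AEStronglyMeasurable p μ) (hΦ : AEStronglyMeasurable Φ μ)
    (hg : ∀ a, ∀ x ∈ Metric.ball (0 : H) r, ContDiffAt ℝ 1 g (p a + Φ a x))
    (hb : ∀ a, ∀ x ∈ Metric.ball (0 : H) r, ‖(fderiv ℝ g (p a + Φ a x)).comp (Φ a)‖ ≤ bound a)
    (hbi : Integrable bound μ)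
    (hint : ∀ x ∈ Metric.ball (0 : H) r, Integrable (fun a ↦ g (p a + Φ a x)) μ) :
    Integrable (fun a ↦ (fderiv ℝ g (p a)).comp (Φ a)) μ ∧
    HasStrictFDerivAt (fun x ↦ ∫ a, g (p a + Φ a x) ∂μ)
      (∫ a, (fderiv ℝ g (p a)).comp (Φ a) ∂μ) 0 := by
  borelize F
  borelize G
  have hball : ∀ x ∈ Metric.ball (0 : H) r, Metric.ball (0 : H) r ∈ 𝓝 x := fun x hx ↦
    Metric.isOpen_ball.mem_nhds hx
  have hm : ∀ x, AEStronglyMeasurable (fun a ↦ (fderiv ℝ g (p a + Φ a x)).comp (Φ a)) μ := by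
    intro x
    have h1 : AEStronglyMeasurable (fun a ↦ p a + Φ a x) μ := hp.add (hΦ.apply_continuousLinearMap x)
    have h2 : AEStronglyMeasurable (fun a ↦ fderiv ℝ g (p a + Φ a x)) μ :=
      ((measurable_fderiv ℝ g).comp_aemeasurable h1.aemeasurable).aestronglyMeasurable
    exact ((ContinuousLinearMap.compL ℝ H F G).continuous₂).comp_aestronglyMeasurable (h2.prodMk hΦ)
  have hd : ∀ a, ∀ x ∈ Metric.ball (0 : H) r, HasFDerivAt (fun x ↦ g (p a + Φ a x))
      ((fderiv ℝ g (p a + Φ a x)).comp (Φ a)) x := by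
    intro a x hx
    exact ((hg a x hx).differentiableAt (by simp)).hasFDerivAt.comp x
      ((Φ a).hasFDerivAt.const_add (p a))
  have h0 : (0 : H) ∈ Metric.ball (0 : H) r := Metric.mem_ball_self hr
  have hder : ∀ x ∈ Metric.ball (0 : H) r, HasFDerivAt (fun x ↦ ∫ a, g (p a + Φ a x) ∂μ)
      (∫ a, (fderiv ℝ g (p a + Φ a x)).comp (Φ a) ∂μ) x := fun x hx ↦
    hasFDerivAt_integral_of_dominated_of_fderiv_le (hball x hx)
      (eventually_of_mem (hball x hx) fun y hy ↦ (hint y hy).1) (hint x hx) (hm x)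
      (ae_of_all _ hb) hbi (ae_of_all _ hd)
  have hcont : ContinuousAt (fun x ↦ ∫ a, (fderiv ℝ g (p a + Φ a x)).comp (Φ a) ∂μ) 0 := by
    refine continuousAt_of_dominated (Eventually.of_forall hm)
      (eventually_of_mem (hball 0 h0) fun y hy ↦ ae_of_all _ fun a ↦ hb a y hy) hbi
      (ae_of_all _ fun a ↦ ?_)
    have h1 : ContinuousAt (fderiv ℝ g) (p a + Φ a 0) := (hg a 0 h0).continuousAt_fderiv (by simp)
    have h2 : ContinuousAt (fun x ↦ fderiv ℝ g (p a + Φ a x)) 0 :=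
      ContinuousAt.comp (f := fun x ↦ p a + Φ a x) h1 (by fun_prop)
    exact h2.clm_comp continuousAt_const
  have e : ∀ a, p a + Φ a 0 = p a := fun a ↦ by simp
  constructor
  · have := hbi.mono' (hm 0) (ae_of_all _ fun a ↦ hb a 0 h0)
    simpa only [e] using this
  · have := hasStrictFDerivAt_of_hasFDerivAt_of_continuousAt
      (eventually_of_mem (hball 0 h0) hder) hcont
    simpa only [e] using this

/-! ### Admissible fields, their variations, and the first variation formulas. -/

theorem IsAdmissible.integrable {L : ℝ} {P V₀ V₁ : E3} {w : ℝ → E3}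
    (hw : IsAdmissible L P V₀ V₁ w) : Integrable w volume :=
  integrable_of_memLp_two hw.memLp hw.eq_zero

theorem IsAdmissible.isPrimitive {L : ℝ} {P V₀ V₁ : E3} {w : ℝ → E3}
    (hw : IsAdmissible L P V₀ V₁ w) : IsPrimitive (tangent V₀ w) w :=
  isPrimitive_tangent hw.integrable V₀

/-- Differentiate the constant `‖T‖² = 1`. -/
theorem IsAdmissible.ae_inner_eq_zero {L : ℝ} {P V₀ V₁ : E3} {w : ℝ → E3}
    (hw : IsAdmissible L P V₀ V₁ w) : ∀ᵐ s, ⟪tangent V₀ w s, w s⟫ = 0 := by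
  filter_upwards [hw.isPrimitive.ae_hasDerivAt] with s hs
  have h1 : HasDerivAt (fun s ↦ ‖tangent V₀ w s‖ ^ 2) (2 * ⟪tangent V₀ w s, w s⟫) s := hs.norm_sq
  have h2 : (fun s ↦ ‖tangent V₀ w s‖ ^ 2) = fun _ ↦ 1 := funext fun s ↦ by
    rw [hw.norm_tangent, one_pow]
  rw [h2] at h1
  have := h1.unique (hasDerivAt_const s (1 : ℝ))
  linarith

/-- A family of variation fields on `(0, L)`, depending linearly on a parameter in `H`. -/
structure IsVariation {H : Type*} [NormedAddCommGroup H] [NormedSpace ℝ H] (L : ℝ)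
    (φ φ' : ℝ → H →L[ℝ] E3) : Prop where
  continuous_deriv : Continuous φ'
  hasDerivAt : ∀ s, HasDerivAt φ (φ' s) s
  eq_zero : ∀ s, s ∉ Ioo 0 L → φ s = 0
  deriv_eq_zero : ∀ s, s ∉ Ioo 0 L → φ' s = 0

namespace IsVariation

variable {H : Type*} [NormedAddCommGroup H] [NormedSpace ℝ H] {L : ℝ} {φ φ' : ℝ → H →L[ℝ] E3}

theorem continuous (h : IsVariation L φ φ') : Continuous φ :=
  continuous_iff_continuousAt.2 fun s ↦ (h.hasDerivAt s).continuousAt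

theorem exists_bound (h : IsVariation L φ φ') :
    ∃ C > 0, ∀ s, ‖φ s‖ ≤ C ∧ ‖φ' s‖ ≤ C := by
  obtain ⟨C₁, h₁⟩ := (isCompact_Icc (a := 0) (b := L)).exists_bound_of_continuousOn
    h.continuous.continuousOn
  obtain ⟨C₂, h₂⟩ := (isCompact_Icc (a := 0) (b := L)).exists_bound_of_continuousOn
    h.continuous_deriv.continuousOn
  refine ⟨max 1 (max C₁ C₂), by positivity, fun s ↦ ?_⟩
  by_cases hs : s ∈ Ioo 0 L
  · exact ⟨(h₁ s (Ioo_subset_Icc_self hs)).trans ((le_max_left _ _).trans (le_max_right _ _)),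
      (h₂ s (Ioo_subset_Icc_self hs)).trans ((le_max_right _ _).trans (le_max_right _ _))⟩
  · rw [h.eq_zero s hs, h.deriv_eq_zero s hs, norm_zero]
    exact ⟨by positivity, by positivity⟩

theorem isPrimitive (h : IsVariation L φ φ') (x : H) :
    IsPrimitive (fun s ↦ φ s x) (fun s ↦ φ' s x) :=
  IsPrimitive.of_hasDerivAt (h.continuous_deriv.clm_apply continuous_const) fun s ↦ by
    simpa using (h.hasDerivAt s).clm_apply (hasDerivAt_const s x)

end IsVariation

section Variation

variable {H : Type*} [NormedAddCommGroup H] [NormedSpace ℝ H] {L : ℝ} {φ φ' : ℝ → H →L[ℝ] E3} {P V₀ V₁ : E3} {w : ℝ → E3}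

/-- The curvature vector field of the varied curve, whose tangent is the radial projection
of `T + φ x`. -/
noncomputable def variedField (V₀ : E3) (w : ℝ → E3) (φ φ' : ℝ → H →L[ℝ] E3) (x : H) (s : ℝ) : E3 :=
  radialDeriv (tangent V₀ w s + φ s x) (w s + φ' s x)

/-- Keeps the perturbed tangent away from the origin, where the radial projection is singular. -/
theorem half_le_norm_add (hw : IsAdmissible L P V₀ V₁ w) {C r : ℝ}
    (hC : ∀ s, ‖φ s‖ ≤ C) (hC0 : 0 < C) (hr : C * r ≤ 1 / 2) {x : H} (hx : x ∈ Metric.ball (0 : H) r)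
    (s : ℝ) : 1 / 2 ≤ ‖tangent V₀ w s + φ s x‖ := by
  have h1 : ‖φ s x‖ ≤ 1 / 2 := by
    refine ((φ s).le_opNorm x).trans (le_trans ?_ hr)
    rw [mem_ball_zero_iff] at hx
    exact mul_le_mul (hC s) hx.le (norm_nonneg _) hC0.le
  have := norm_sub_le_norm_add (tangent V₀ w s) (φ s x)
  rw [hw.norm_tangent] at this
  linarith

theorem norm_add_deriv_le {C r : ℝ} (hC : ∀ s, ‖φ' s‖ ≤ C) (hC0 : 0 < C) (hr : C * r ≤ 1 / 2)
    {x : H} (hx : x ∈ Metric.ball (0 : H) r) (s : ℝ) : ‖w s + φ' s x‖ ≤ ‖w s‖ + 1 := by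
  have h1 : ‖φ' s x‖ ≤ 1 / 2 := by
    refine ((φ' s).le_opNorm x).trans (le_trans ?_ hr)
    rw [mem_ball_zero_iff] at hx
    exact mul_le_mul (hC s) hx.le (norm_nonneg _) hC0.le
  linarith [norm_add_le (w s) (φ' s x)]

theorem norm_variedField_le (hw : IsAdmissible L P V₀ V₁ w) {C r : ℝ}
    (hC : ∀ s, ‖φ s‖ ≤ C ∧ ‖φ' s‖ ≤ C) (hC0 : 0 < C) (hr : C * r ≤ 1 / 2)
    {x : H} (hx : x ∈ Metric.ball (0 : H) r) (s : ℝ) :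
    ‖variedField V₀ w φ φ' x s‖ ≤ 2 * (‖w s‖ + 1) := by
  have h1 := half_le_norm_add hw (fun s ↦ (hC s).1) hC0 hr hx s
  have h2 : 0 < ‖tangent V₀ w s + φ s x‖ := by linarith
  refine (norm_radialDeriv_le (norm_pos_iff.1 h2) _).trans ?_
  refine mul_le_mul ?_ (norm_add_deriv_le (fun s ↦ (hC s).2) hC0 hr hx s) (norm_nonneg _) two_pos.le
  rw [inv_le_comm₀ h2 two_pos]; linarith

theorem aestronglyMeasurable_variedField (hw : IsAdmissible L P V₀ V₁ w)
    (h : IsVariation L φ φ') (x : H) :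
    AEStronglyMeasurable (variedField V₀ w φ φ' x) volume := by
  have hT : Continuous fun s ↦ tangent V₀ w s + φ s x :=
    hw.isPrimitive.continuous.add (h.continuous.clm_apply continuous_const)
  have hY : AEStronglyMeasurable (fun s ↦ w s + φ' s x) volume :=
    hw.memLp.1.add (h.continuous_deriv.clm_apply continuous_const).aestronglyMeasurable
  unfold variedField
  simp only [radialDeriv_apply]
  have hn : AEStronglyMeasurable (fun s ↦ ‖tangent V₀ w s + φ s x‖⁻¹) volume :=
    (hT.norm.measurable.inv).aestronglyMeasurable
  exact (hn.smul hY).sub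
    (((hn.pow 3).mul (hT.aestronglyMeasurable.inner hY)).smul hT.aestronglyMeasurable)

theorem variedField_eq_zero (hw : IsAdmissible L P V₀ V₁ w) (h : IsVariation L φ φ') (x : H)
    {s : ℝ} (hs : s ∉ Ioo 0 L) : variedField V₀ w φ φ' x s = 0 := by
  simp [variedField, hw.eq_zero s hs, h.deriv_eq_zero s hs]

theorem tangent_variedField (hw : IsAdmissible L P V₀ V₁ w) (h : IsVariation L φ φ') {x : H}
    (hx : ∀ s, 1 / 2 ≤ ‖tangent V₀ w s + φ s x‖) (s : ℝ) :
    tangent V₀ (variedField V₀ w φ φ' x) s = radial (tangent V₀ w s + φ s x) := by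
  have hp := (hw.isPrimitive.add (h.isPrimitive x)).radial hx
  have h0 : radial (tangent V₀ w 0 + φ 0 x) = V₀ := by
    rw [h.eq_zero 0 (by simp), _root_.zero_apply, add_zero,
      radial_of_norm_eq_one (hw.norm_tangent 0), tangent_zero]
  rw [hp.eq s, h0]
  rfl

theorem memLp_variedField (hw : IsAdmissible L P V₀ V₁ w) (h : IsVariation L φ φ') {C r : ℝ}
    (hC : ∀ s, ‖φ s‖ ≤ C ∧ ‖φ' s‖ ≤ C) (hC0 : 0 < C) (hr : C * r ≤ 1 / 2)
    {x : H} (hx : x ∈ Metric.ball (0 : H) r) : MemLp (variedField V₀ w φ φ' x) 2 volume := by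
  have hind : MemLp (indicator (Ioo 0 L) fun s ↦ 2 * (‖w s‖ + 1)) 2 volume := by
    rw [memLp_indicator_iff_restrict measurableSet_Ioo]
    exact ((hw.memLp.norm.restrict _).add (memLp_const 1)).const_mul 2
  refine hind.mono' (aestronglyMeasurable_variedField hw h x) (ae_of_all _ fun s ↦ ?_)
  by_cases hs : s ∈ Ioo 0 L
  · rw [indicator_of_mem hs]
    exact norm_variedField_le hw hC hC0 hr hx s
  · rw [indicator_of_notMem hs, variedField_eq_zero hw h x hs, norm_zero]

/-- Unit speed is automatic by projection, and the end tangents are kept because `φ` vanishes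
outside `(0, L)`. Only the displacement `hF` remains to be imposed. -/
theorem isAdmissible_variedField (hL : 0 < L) (hw : IsAdmissible L P V₀ V₁ w)
    (h : IsVariation L φ φ') {C r : ℝ}
    (hC : ∀ s, ‖φ s‖ ≤ C ∧ ‖φ' s‖ ≤ C) (hC0 : 0 < C) (hr : C * r ≤ 1 / 2)
    {x : H} (hx : x ∈ Metric.ball (0 : H) r)
    (hF : ∫ s in Ioo 0 L, radial (tangent V₀ w s + φ s x) = P) :
    IsAdmissible L P V₀ V₁ (variedField V₀ w φ φ' x) := by
  have h1 := half_le_norm_add hw (fun s ↦ (hC s).1) hC0 hr hx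
  have hT := tangent_variedField hw h h1
  refine ⟨memLp_variedField hw h hC hC0 hr hx, fun s ↦ variedField_eq_zero hw h x, fun s ↦ ?_, ?_, ?_⟩
  · rw [hT]
    exact norm_radial (norm_pos_iff.1 (by linarith [h1 s]))
  · rw [hT, h.eq_zero L (by simp), _root_.zero_apply, add_zero,
      radial_of_norm_eq_one (hw.norm_tangent L), hw.tangent_end]
  · simp only [hT]
    rw [intervalIntegral.integral_of_le hL.le, integral_Ioc_eq_integral_Ioo, hF]

/-- Dominated convergence. At `x = 0` the varied field is the part of `w` orthogonal to the tangent,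
which is `w` itself almost everywhere. -/
theorem tendsto_integral_variedField_sub (hw : IsAdmissible L P V₀ V₁ w)
    (h : IsVariation L φ φ') :
    Tendsto (fun x ↦ ∫ s, ‖variedField V₀ w φ φ' x s - w s‖ ^ 2) (𝓝 0) (𝓝 0) := by
  obtain ⟨C, hC0, hC⟩ := h.exists_bound
  have hr : C * (2 * C)⁻¹ ≤ 1 / 2 := le_of_eq (by field_simp)
  have hball : Metric.ball (0 : H) (2 * C)⁻¹ ∈ 𝓝 0 := Metric.ball_mem_nhds _ (by positivity)
  have e : ∀ x, ∫ s in Ioo 0 L, ‖variedField V₀ w φ φ' x s - w s‖ ^ 2 =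
      ∫ s, ‖variedField V₀ w φ φ' x s - w s‖ ^ 2 := fun x ↦
    setIntegral_norm_sq_eq (w := fun s ↦ variedField V₀ w φ φ' x s - w s)
      fun s hs ↦ by rw [variedField_eq_zero hw h x hs, hw.eq_zero s hs, sub_zero]
  simp only [← e]
  have hlim := tendsto_integral_filter_of_dominated_convergence
    (F := fun x s ↦ ‖variedField V₀ w φ φ' x s - w s‖ ^ 2) (f := fun _ ↦ 0)
    (μ := volume.restrict (Ioo 0 L)) (l := 𝓝 0)
    (fun s ↦ (3 * (‖w s‖ + 1)) ^ 2) ?_ ?_ ?_ ?_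
  · simpa using hlim
  · exact Eventually.of_forall fun x ↦
      (((aestronglyMeasurable_variedField hw h x).sub hw.memLp.1).norm.pow 2).restrict
  · filter_upwards [hball] with x hx
    refine ae_of_all _ fun s ↦ ?_
    rw [norm_pow, norm_norm]
    gcongr
    linarith [norm_sub_le (variedField V₀ w φ φ' x s) (w s), norm_variedField_le hw hC hC0 hr hx s]
  · have : MemLp (fun s ↦ 3 * (‖w s‖ + 1)) 2 (volume.restrict (Ioo 0 L)) :=
      ((hw.memLp.norm.restrict _).add (memLp_const 1)).const_mul 3
    exact this.integrable_sq
  · filter_upwards [ae_restrict_of_ae hw.ae_inner_eq_zero] with s hs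
    have hne : tangent V₀ w s + φ s 0 ≠ 0 := by
      rw [map_zero, add_zero, ← norm_pos_iff, hw.norm_tangent]
      exact one_pos
    have hc : ContinuousAt (fun x ↦ ‖variedField V₀ w φ φ' x s - w s‖ ^ 2) 0 := by
      unfold variedField
      simp only [radialDeriv_apply]
      have h1 : ContinuousAt (fun x : H ↦ ‖tangent V₀ w s + φ s x‖⁻¹) 0 :=
        ContinuousAt.inv₀ (by fun_prop) (norm_ne_zero_iff.2 hne)
      fun_prop
    have := hc.tendsto
    simpa [variedField, radialDeriv_apply, hw.norm_tangent, hs] using this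

variable [FiniteDimensional ℝ H]

/-- First variation of the displacement. -/
theorem hasStrictFDerivAt_displacement (hw : IsAdmissible L P V₀ V₁ w) (h : IsVariation L φ φ') :
    ∃ D : H →L[ℝ] E3, HasStrictFDerivAt
        (fun x ↦ ∫ s in Ioo 0 L, radial (tangent V₀ w s + φ s x)) D 0 ∧
      ∀ x, D x = ∫ s in Ioo 0 L, (φ s x - ⟪tangent V₀ w s, φ s x⟫ • tangent V₀ w s) := by
  obtain ⟨C, hC0, hC⟩ := h.exists_bound
  have hr : C * (2 * C)⁻¹ ≤ 1 / 2 := le_of_eq (by field_simp)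
  have hT := hw.isPrimitive.continuous
  have hhalf := fun x hx ↦ half_le_norm_add (x := x) hw (fun s ↦ (hC s).1) hC0 hr hx
  have hpos : ∀ x ∈ Metric.ball (0 : H) (2 * C)⁻¹, ∀ s, 0 < ‖tangent V₀ w s + φ s x‖ :=
    fun x hx s ↦ by linarith [hhalf x hx s]
  obtain ⟨hi, hd⟩ := hasStrictFDerivAt_integral_comp_affine (μ := volume.restrict (Ioo 0 L))
    (g := radial) (p := tangent V₀ w) (Φ := φ) (bound := fun _ ↦ 2 * C) (r := (2 * C)⁻¹)
    (by positivity) hT.aestronglyMeasurable h.continuous.aestronglyMeasurable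
    (fun s x hx ↦ contDiffAt_radial (norm_pos_iff.1 (hpos x hx s)))
    (fun s x hx ↦ by
      have hne := norm_pos_iff.1 (hpos x hx s)
      rw [(hasFDerivAt_radial hne).fderiv]
      refine (ContinuousLinearMap.opNorm_comp_le _ _).trans ?_
      refine mul_le_mul ?_ (hC s).1 (norm_nonneg _) two_pos.le
      refine ContinuousLinearMap.opNorm_le_bound _ two_pos.le fun Y ↦ ?_
      refine (norm_radialDeriv_le hne Y).trans ?_
      gcongr
      rw [inv_le_comm₀ (hpos x hx s) two_pos]; linarith [hhalf x hx s])
    (integrable_const _)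
    (fun x hx ↦ by
      refine Integrable.of_bound (C := 1) ?_ (ae_of_all _ fun s ↦
        (norm_radial (norm_pos_iff.1 (hpos x hx s))).le)
      have hc : Continuous fun s ↦ tangent V₀ w s + φ s x :=
        hT.add (h.continuous.clm_apply continuous_const)
      exact (Continuous.smul (hc.norm.inv₀ fun s ↦ (hpos x hx s).ne') hc).aestronglyMeasurable)
  refine ⟨_, hd, fun x ↦ ?_⟩
  rw [ContinuousLinearMap.integral_apply hi]
  refine integral_congr_ae (ae_of_all _ fun s ↦ ?_)
  have hne : tangent V₀ w s ≠ 0 := by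
    rw [← norm_pos_iff, hw.norm_tangent]; exact one_pos
  simp [(hasFDerivAt_radial hne).fderiv, radialDeriv_apply, hw.norm_tangent]

/-- First variation of the bending energy. -/
theorem hasStrictFDerivAt_energy (hw : IsAdmissible L P V₀ V₁ w) (h : IsVariation L φ φ') :
    ∃ D : H →L[ℝ] ℝ, HasStrictFDerivAt
        (fun x ↦ ∫ s in Ioo 0 L, density (tangent V₀ w s + φ s x, w s + φ' s x)) D 0 ∧
      ∀ x, D x = 2 * ∫ s in Ioo 0 L, (⟪w s, φ' s x⟫ - ‖w s‖ ^ 2 * ⟪tangent V₀ w s, φ s x⟫) := by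
  obtain ⟨C, hC0, hC⟩ := h.exists_bound
  have hr : C * (2 * C)⁻¹ ≤ 1 / 2 := le_of_eq (by field_simp)
  have hT := hw.isPrimitive.continuous
  have hhalf := fun x hx ↦ half_le_norm_add (x := x) hw (fun s ↦ (hC s).1) hC0 hr hx
  have hpos : ∀ x ∈ Metric.ball (0 : H) (2 * C)⁻¹, ∀ s, 0 < ‖tangent V₀ w s + φ s x‖ :=
    fun x hx s ↦ by linarith [hhalf x hx s]
  have hΦ : Continuous fun s ↦ (φ s).prod (φ' s) :=
    (ContinuousLinearMap.prodₗᵢ (𝕜 := ℝ) (E := H) (F := E3) (G := E3) ℝ).continuous.comp (h.continuous.prodMk h.continuous_deriv)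
  obtain ⟨hi, hd⟩ := hasStrictFDerivAt_integral_comp_affine (μ := volume.restrict (Ioo 0 L))
    (g := density) (p := fun s ↦ (tangent V₀ w s, w s)) (Φ := fun s ↦ (φ s).prod (φ' s))
    (bound := fun s ↦ 64 * (‖w s‖ + 2) ^ 2 * C) (r := (2 * C)⁻¹)
    (by positivity) (hT.aestronglyMeasurable.prodMk hw.memLp.1.restrict) hΦ.aestronglyMeasurable
    (fun s x hx ↦ contDiffAt_density (norm_pos_iff.1 (hpos x hx s)))
    (fun s x hx ↦ by
      refine (ContinuousLinearMap.opNorm_comp_le _ _).trans ?_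
      refine mul_le_mul ?_ ?_ (norm_nonneg _) (by positivity)
      · refine (norm_fderiv_density_le (hhalf x hx s) _).trans ?_
        have := norm_add_deriv_le (w := w) (fun s ↦ (hC s).2) hC0 hr hx s
        have : 1 + ‖w s + φ' s x‖ ≤ ‖w s‖ + 2 := by linarith
        exact mul_le_mul_of_nonneg_left (pow_le_pow_left₀ (by positivity) this 2) (by norm_num)
      · rw [ContinuousLinearMap.opNorm_prod]
        exact max_le (hC s).1 (hC s).2)
    (by
      have : MemLp (fun s ↦ ‖w s‖ + 2) 2 (volume.restrict (Ioo 0 L)) :=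
        (hw.memLp.norm.restrict _).add (memLp_const 2)
      exact (this.integrable_sq.const_mul 64).mul_const C)
    (fun x hx ↦ by
      refine ((integrable_norm_sq (memLp_variedField hw h hC hC0 hr hx)).restrict).congr
        (ae_of_all _ fun s ↦ ?_)
      exact norm_radialDeriv_sq (norm_pos_iff.1 (hpos x hx s)) _)
  refine ⟨_, hd, fun x ↦ ?_⟩
  rw [ContinuousLinearMap.integral_apply hi, ← integral_const_mul]
  refine integral_congr_ae ?_
  filter_upwards [ae_restrict_of_ae hw.ae_inner_eq_zero] with s hs
  have hne : tangent V₀ w s ≠ 0 := by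
    rw [← norm_pos_iff, hw.norm_tangent]; exact one_pos
  simp only [ContinuousLinearMap.comp_apply, ContinuousLinearMap.prod_apply]
  rw [fderiv_density_apply hne, hw.norm_tangent, hs]
  ring

/-- The first variations of displacement and energy are linearly dependent at a local minimum. -/
theorem range_firstVariation_ne_top (hL : 0 < L) (hw : IsAdmissible L P V₀ V₁ w)
    (hmin : IsLocalMinField L P V₀ V₁ w) (h : IsVariation L φ φ') {D : H →L[ℝ] E3} {D' : H →L[ℝ] ℝ}
    (hD : ∀ x, D x = ∫ s in Ioo 0 L, (φ s x - ⟪tangent V₀ w s, φ s x⟫ • tangent V₀ w s))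
    (hD' : ∀ x, D' x =
      2 * ∫ s in Ioo 0 L, (⟪w s, φ' s x⟫ - ‖w s‖ ^ 2 * ⟪tangent V₀ w s, φ s x⟫)) :
    (D.prod D').range ≠ ⊤ := by
  obtain ⟨D₁, h1, e1⟩ := hasStrictFDerivAt_displacement hw h
  obtain ⟨D₂, h2, e2⟩ := hasStrictFDerivAt_energy hw h
  obtain rfl : D = D₁ := ContinuousLinearMap.ext fun x ↦ (hD x).trans (e1 x).symm
  obtain rfl : D' = D₂ := ContinuousLinearMap.ext fun x ↦ (hD' x).trans (e2 x).symm
  have : CompleteSpace H := FiniteDimensional.complete ℝ H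
  -- Lagrange multipliers in the parameter space `H`: the energy has a local minimum at `0` on the
  -- level set of the displacement.
  refine IsLocalExtrOn.range_ne_top_of_hasStrictFDerivAt (Or.inl ?_) h1 h2
  obtain ⟨C, hC0, hC⟩ := h.exists_bound
  have hr : C * (2 * C)⁻¹ ≤ 1 / 2 := le_of_eq (by field_simp)
  have hball : Metric.ball (0 : H) (2 * C)⁻¹ ∈ 𝓝 0 := Metric.ball_mem_nhds _ (by positivity)
  obtain ⟨δ, hδ, hmin⟩ := hmin
  have hlt := (tendsto_integral_variedField_sub hw h).eventually_lt_const hδ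
  have hE : ∀ x ∈ Metric.ball (0 : H) (2 * C)⁻¹,
      ∫ s in Ioo 0 L, density (tangent V₀ w s + φ s x, w s + φ' s x) =
        ∫ s, ‖variedField V₀ w φ φ' x s‖ ^ 2 := by
    intro x hx
    rw [← setIntegral_norm_sq_eq fun s hs ↦ variedField_eq_zero hw h x hs]
    refine integral_congr_ae (ae_of_all _ fun s ↦ ?_)
    have := half_le_norm_add hw (fun s ↦ (hC s).1) hC0 hr hx s
    exact (norm_radialDeriv_sq (norm_pos_iff.1 (by linarith)) _).symm
  have hE0 : ∫ s, ‖variedField V₀ w φ φ' 0 s‖ ^ 2 = ∫ s, ‖w s‖ ^ 2 := by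
    refine integral_congr_ae ?_
    filter_upwards [hw.ae_inner_eq_zero] with s hs
    simp [variedField, radialDeriv_apply, hw.norm_tangent, hs]
  have hF0 : ∫ s in Ioo 0 L, radial (tangent V₀ w s + φ s 0) = P := by
    rw [← hw.integral_tangent, intervalIntegral.integral_of_le hL.le, integral_Ioc_eq_integral_Ioo]
    refine integral_congr_ae (ae_of_all _ fun s ↦ ?_)
    simp [radial_of_norm_eq_one (hw.norm_tangent s)]
  refine eventually_nhdsWithin_iff.2 ?_
  filter_upwards [hball, hlt] with x hx hx' hxF
  rw [hE x hx, hE 0 (Metric.mem_ball_self (by positivity)), hE0]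
  refine hmin _ (isAdmissible_variedField hL hw h hC hC0 hr hx ?_) hx'
  rw [← hF0]
  exact hxF

end Variation

/-! ### Elasticae and their unique continuation. -/

/-- The hypothesis forces `⟪μ, T⟫ = ±‖μ‖`, and connectedness fixes the sign. It excludes abnormal
multipliers and also handles two elasticae with different multipliers. -/
theorem exists_eq_const_of_forall_eq_inner_smul {S : Set ℝ} (hS : IsPreconnected S) {T : ℝ → E3}
    (hT : ContinuousOn T S) (hunit : ∀ s ∈ S, ‖T s‖ = 1) {μ : E3} (hμ : μ ≠ 0)
    (h : ∀ s ∈ S, μ = ⟪μ, T s⟫ • T s) : ∃ c, ∀ s ∈ S, T s = c := by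
  have hn : ‖μ‖ ≠ 0 := norm_ne_zero_iff.2 hμ
  have hsq : EqOn ((fun s ↦ ⟪μ, T s⟫) ^ 2) ((fun _ ↦ ‖μ‖) ^ 2) S := fun s hs ↦ by
    have h1 : ‖μ‖ = ‖⟪μ, T s⟫ • T s‖ := congrArg _ (h s hs)
    rw [norm_smul, hunit s hs, mul_one] at h1
    simp only [Pi.pow_apply, h1, Real.norm_eq_abs, sq_abs]
  rcases hS.eq_or_eq_neg_of_sq_eq (f := fun s ↦ ⟪μ, T s⟫) (g := fun _ ↦ ‖μ‖)
    (continuousOn_const.inner hT) continuousOn_const hsq (fun _ ↦ hn) with h1 | h1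
  · refine ⟨‖μ‖⁻¹ • μ, fun s hs ↦ ?_⟩
    have h2 : ⟪μ, T s⟫ = ‖μ‖ := h1 hs
    have h3 := h s hs
    rw [h2] at h3
    nth_rewrite 2 [h3]
    rw [smul_smul, inv_mul_cancel₀ hn, one_smul]
  · refine ⟨-(‖μ‖⁻¹ • μ), fun s hs ↦ ?_⟩
    have h2 : ⟪μ, T s⟫ = -‖μ‖ := h1 hs
    have h3 := h s hs
    rw [h2] at h3
    nth_rewrite 2 [h3]
    rw [neg_smul, smul_neg, neg_neg, smul_smul, inv_mul_cancel₀ hn, one_smul]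

/-- The acceleration of the unit tangent of an elastica with multiplier `Λ`, as a function of the
tangent and the curvature vector. -/
noncomputable def elasticaField (Λ : E3) (p : E3 × E3) : E3 :=
  -(‖p.2‖ ^ 2 • p.1 + (Λ - ⟪Λ, p.1⟫ • p.1))

/-- `T` and `K` are the unit tangent and the curvature vector of an elastica on `(0, L)`. -/
structure IsElastica (L : ℝ) (Λ : E3) (T K : ℝ → E3) : Prop where
  continuous_tangent : Continuous T
  continuous_curvature : Continuous K
  norm_tangent : ∀ s, ‖T s‖ = 1
  hasDerivAt_tangent : ∀ s ∈ Ioo 0 L, HasDerivAt T (K s) s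
  hasDerivAt_curvature : ∀ s ∈ Ioo 0 L, HasDerivAt K (elasticaField Λ (T s, K s)) s

theorem contDiff_elasticaField (Λ : E3) : ContDiff ℝ 1 (elasticaField Λ) := by
  have h1 : ContDiff ℝ 1 fun p : E3 × E3 ↦ ‖p.2‖ ^ 2 := contDiff_snd.norm_sq ℝ
  have h2 : ContDiff ℝ 1 fun p : E3 × E3 ↦ ⟪Λ, p.1⟫ := contDiff_const.inner ℝ contDiff_fst
  exact ((h1.smul contDiff_fst).add (contDiff_const.sub (h2.smul contDiff_fst))).neg

/-- The vector field is only locally Lipschitz, so ODE uniqueness is applied in a ball containing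
both trajectories over `[0, L]`. -/
theorem IsElastica.eqOn {L : ℝ} {Λ : E3} {T K T' K' : ℝ → E3} (h : IsElastica L Λ T K)
    (h' : IsElastica L Λ T' K') {t : ℝ} (ht : t ∈ Ioo 0 L) (hT : T t = T' t) (hK : K t = K' t) :
    EqOn K K' (Icc 0 L) := by
  have hc : Continuous fun s ↦ (T s, K s) := h.continuous_tangent.prodMk h.continuous_curvature
  have hc' : Continuous fun s ↦ (T' s, K' s) := h'.continuous_tangent.prodMk h'.continuous_curvature
  obtain ⟨C, hC⟩ := (isCompact_Icc (a := 0) (b := L)).exists_bound_of_continuousOn hc.continuousOn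
  obtain ⟨C', hC'⟩ := (isCompact_Icc (a := 0) (b := L)).exists_bound_of_continuousOn
    hc'.continuousOn
  set B := Metric.closedBall (0 : E3 × E3) (max C C')
  have hv : ContDiff ℝ 1 fun p : E3 × E3 ↦ (p.2, elasticaField Λ p) :=
    contDiff_snd.prodMk (contDiff_elasticaField Λ)
  obtain ⟨k, hk⟩ := hv.contDiffOn.exists_lipschitzOnWith (s := B) (by decide)
    (convex_closedBall _ _) (isCompact_closedBall _ _)
  have := ODE_solution_unique_of_mem_Icc (v := fun _ p ↦ (p.2, elasticaField Λ p)) (s := fun _ ↦ B)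
    (fun _ _ ↦ hk) ht hc.continuousOn
    (fun s hs ↦ (h.hasDerivAt_tangent s hs).prodMk (h.hasDerivAt_curvature s hs))
    (fun s hs ↦ mem_closedBall_zero_iff.2
      ((hC s (Ioo_subset_Icc_self hs)).trans (le_max_left _ _))) hc'.continuousOn
    (fun s hs ↦ (h'.hasDerivAt_tangent s hs).prodMk (h'.hasDerivAt_curvature s hs))
    (fun s hs ↦ mem_closedBall_zero_iff.2
      ((hC' s (Ioo_subset_Icc_self hs)).trans (le_max_right _ _))) (Prod.ext hT hK)
  exact fun s hs ↦ congrArg Prod.snd (this hs)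

/-- On the straight piece `K` and its derivative vanish, so `(c, 0)` is an equilibrium of the ODE;
uniqueness then spreads it over `[0, L]`. -/
theorem IsElastica.eqOn_zero {L a b : ℝ} {Λ c : E3} {T K : ℝ → E3} (h : IsElastica L Λ T K)
    (hab : a < b) (hsub : Ioo a b ⊆ Ioo 0 L) (hc : ∀ s ∈ Ioo a b, T s = c) :
    EqOn K 0 (Icc 0 L) := by
  have hK : ∀ s ∈ Ioo a b, K s = 0 := fun s hs ↦
    (h.hasDerivAt_tangent s (hsub hs)).unique ((hasDerivAt_const s c).congr_of_eventuallyEq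
      (eventually_of_mem (Ioo_mem_nhds hs.1 hs.2) hc))
  have ht : (a + b) / 2 ∈ Ioo a b := ⟨by linarith, by linarith⟩
  have hz := (h.hasDerivAt_curvature _ (hsub ht)).unique
    ((hasDerivAt_const _ (0 : E3)).congr_of_eventuallyEq
      (eventually_of_mem (Ioo_mem_nhds ht.1 ht.2) hK))
  rw [hc _ ht, hK _ ht] at hz
  have h' : IsElastica L Λ (fun _ ↦ c) (fun _ ↦ 0) :=
    ⟨continuous_const, continuous_const, fun _ ↦ by rw [← hc _ ht, h.norm_tangent],
      fun s _ ↦ hasDerivAt_const s c, fun s _ ↦ by rw [hz]; exact hasDerivAt_const s 0⟩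
  exact h.eqOn h' (hsub ht) (hc _ ht) (hK _ ht)

/-- The multipliers may differ. Comparing the two equations on `(a, b)` shows that `Λ - Λ'` is
tangential there, so either it vanishes and ODE uniqueness applies, or `T` is constant on `(a, b)`
and both curvatures vanish identically. -/
theorem IsElastica.eqOn_of_eqOn_Ioo {L a b : ℝ} {Λ Λ' : E3} {T K T' K' : ℝ → E3}
    (h : IsElastica L Λ T K) (h' : IsElastica L Λ' T' K') (hab : a < b)
    (hsub : Ioo a b ⊆ Ioo 0 L) (hT : EqOn T T' (Ioo a b)) : EqOn K K' (Icc 0 L) := by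
  have hK : ∀ s ∈ Ioo a b, K s = K' s := fun s hs ↦
    (h.hasDerivAt_tangent s (hsub hs)).unique
      ((h'.hasDerivAt_tangent s (hsub hs)).congr_of_eventuallyEq
        (eventually_of_mem (Ioo_mem_nhds hs.1 hs.2) hT))
  have hF : ∀ s ∈ Ioo a b, elasticaField Λ (T s, K s) = elasticaField Λ' (T s, K s) := by
    intro s hs
    have := (h.hasDerivAt_curvature s (hsub hs)).unique
      ((h'.hasDerivAt_curvature s (hsub hs)).congr_of_eventuallyEq
        (eventually_of_mem (Ioo_mem_nhds hs.1 hs.2) hK))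
    rw [this, hT hs, hK s hs]
  have hμ : ∀ s ∈ Ioo a b, Λ - Λ' = ⟪Λ - Λ', T s⟫ • T s := by
    intro s hs
    have h1 := hF s hs
    simp only [elasticaField, neg_inj, add_right_inj] at h1
    rw [inner_sub_left, sub_smul]
    rw [sub_eq_sub_iff_sub_eq_sub] at h1
    exact h1
  have ht : (a + b) / 2 ∈ Ioo a b := ⟨by linarith, by linarith⟩
  rcases eq_or_ne (Λ - Λ') 0 with h0 | h0
  · obtain rfl := sub_eq_zero.1 h0
    exact h.eqOn h' (hsub ht) (hT ht) (hK _ ht)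
  · obtain ⟨c, hc⟩ := exists_eq_const_of_forall_eq_inner_smul isPreconnected_Ioo
      h.continuous_tangent.continuousOn (fun s _ ↦ h.norm_tangent s) h0 hμ
    exact (h.eqOn_zero hab hsub hc).trans
      (h'.eqOn_zero hab hsub fun s hs ↦ (hT hs).symm.trans (hc s hs)).symm

/-! ### The Euler–Lagrange equation and regularity. -/

/-- Smooth functions with compact support in `(0, L)`. -/
def IsTestFunction (L : ℝ) (ψ : ℝ → ℝ) : Prop :=
  ContDiff ℝ ∞ ψ ∧ HasCompactSupport ψ ∧ tsupport ψ ⊆ Ioo 0 L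

theorem isVariation_sum {L : ℝ} {n : ℕ} {ψ : Fin n → ℝ → ℝ} (hψ : ∀ i, IsTestFunction L (ψ i))
    (v : Fin n → E3) :
    IsVariation L
      (fun s ↦ ∑ i, ψ i s • (ContinuousLinearMap.proj (R := ℝ) (φ := fun _ : Fin n ↦ ℝ) i).smulRight (v i))
      (fun s ↦ ∑ i, deriv (ψ i) s •
        (ContinuousLinearMap.proj (R := ℝ) (φ := fun _ : Fin n ↦ ℝ) i).smulRight (v i)) where
  continuous_deriv := continuous_finsetSum _ fun i _ ↦
    ((hψ i).1.continuous_deriv (by simp)).smul continuous_const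
  hasDerivAt s := by
    have := HasDerivAt.fun_sum (u := Finset.univ) fun i _ ↦
      (((hψ i).1.differentiable (by simp)).differentiableAt (x := s)).hasDerivAt.smul_const
        ((ContinuousLinearMap.proj (R := ℝ) (φ := fun _ : Fin n ↦ ℝ) i).smulRight (v i))
    exact this
  eq_zero s hs := Finset.sum_eq_zero fun i _ ↦ by
    rw [image_eq_zero_of_notMem_tsupport fun h ↦ hs ((hψ i).2.2 h)]
    exact ContinuousLinearMap.ext fun x ↦ zero_smul ℝ (x i • v i)
  deriv_eq_zero s hs := Finset.sum_eq_zero fun i _ ↦ by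
    rw [image_eq_zero_of_notMem_tsupport fun h ↦ hs ((hψ i).2.2 (tsupport_deriv_subset h))]
    exact ContinuousLinearMap.ext fun x ↦ zero_smul ℝ (x i • v i)

section EulerLagrange

variable {L : ℝ} {P V₀ V₁ : E3} {w : ℝ → E3}

/-- Displacement and energy variation for the field `ψ v`. -/
noncomputable def firstVariation (L : ℝ) (V₀ : E3) (w : ℝ → E3) (ψ : ℝ → ℝ) (v : E3) : E3 × ℝ :=
  (∫ s in Ioo 0 L, (ψ s • v - ⟪tangent V₀ w s, ψ s • v⟫ • tangent V₀ w s),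
    2 * ∫ s in Ioo 0 L, (⟪w s, deriv ψ s • v⟫ - ‖w s‖ ^ 2 * ⟪tangent V₀ w s, ψ s • v⟫))

/-- If these vectors spanned the finite-dimensional target, finitely many would already do so. The
family they generate would have a surjective first variation, against `range_firstVariation_ne_top`.
-/
theorem span_firstVariation_ne_top (hL : 0 < L) (hw : IsAdmissible L P V₀ V₁ w)
    (hmin : IsLocalMinField L P V₀ V₁ w) :
    Submodule.span ℝ {p | ∃ ψ v, IsTestFunction L ψ ∧ p = firstVariation L V₀ w ψ v} ≠ ⊤ := by
  intro htop
  obtain ⟨n, f, hf, hspan, -⟩ : ∃ n, ∃ f : Fin n → E3 × ℝ,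
      (∀ i, f i ∈ {p | ∃ ψ v, IsTestFunction L ψ ∧ p = firstVariation L V₀ w ψ v}) ∧
      Submodule.span ℝ (range f) =
        Submodule.span ℝ {p | ∃ ψ v, IsTestFunction L ψ ∧ p = firstVariation L V₀ w ψ v} ∧
      LinearIndependent ℝ f :=
    ⟨_, Submodule.exists_fun_fin_finrank_span_eq ℝ
      {p | ∃ ψ v, IsTestFunction L ψ ∧ p = firstVariation L V₀ w ψ v}⟩
  choose ψ v hψ hfv using hf
  have hvar := isVariation_sum hψ v
  obtain ⟨D, -, hD⟩ := hasStrictFDerivAt_displacement hw hvar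
  obtain ⟨D', -, hD'⟩ := hasStrictFDerivAt_energy hw hvar
  refine range_firstVariation_ne_top hL hw hmin hvar hD hD' ?_
  rw [eq_top_iff, ← htop, ← hspan, Submodule.span_le]
  rintro - ⟨i, rfl⟩
  refine ⟨Pi.single i 1, ?_⟩
  have e : ∀ c : Fin _ → ℝ, (∑ j, c j • (ContinuousLinearMap.proj (R := ℝ)
      (φ := fun _ ↦ ℝ) j).smulRight (v j)) (Pi.single i 1) = c i • v i := by
    intro c
    rw [_root_.sum_apply, Finset.sum_eq_single i]
    · simp
    · intro j _ hj
      simp [Pi.single_eq_of_ne hj]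
    · simp
  rw [hfv i]
  change (D (Pi.single i 1), D' (Pi.single i 1)) = _
  rw [hD, hD', firstVariation]
  simp only [e (fun j ↦ ψ j _), e (fun j ↦ deriv (ψ j) _)]

/-- The Lagrange multiplier rule, in weak form. -/
theorem exists_multiplier (hL : 0 < L) (hw : IsAdmissible L P V₀ V₁ w)
    (hmin : IsLocalMinField L P V₀ V₁ w) :
    ∃ (Λ : E3) (m : ℝ), (Λ ≠ 0 ∨ m ≠ 0) ∧ ∀ ψ v, IsTestFunction L ψ →
      ⟪Λ, (firstVariation L V₀ w ψ v).1⟫ + m * (firstVariation L V₀ w ψ v).2 = 0 := by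
  -- A proper subspace lies in the kernel of a nonzero functional, whose two components are `Λ` (by
  -- Riesz) and `m`.
  obtain ⟨f, hf0, hf⟩ := Submodule.exists_le_ker_of_lt_top _
    (lt_top_iff_ne_top.2 (span_firstVariation_ne_top hL hw hmin))
  set g : E3 →L[ℝ] ℝ := LinearMap.toContinuousLinearMap (f.comp (LinearMap.inl ℝ E3 ℝ))
  have hg : ∀ a, ⟪(InnerProductSpace.toDual ℝ E3).symm g, a⟫ = f (a, 0) := fun a ↦ by
    rw [InnerProductSpace.toDual_symm_apply]
    rfl
  have hfp : ∀ p : E3 × ℝ, f p = f (p.1, 0) + f (0, 1) * p.2 := fun p ↦ by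
    rw [mul_comm, ← smul_eq_mul, ← map_smul, ← map_add]
    congr 1
    simp
  refine ⟨(InnerProductSpace.toDual ℝ E3).symm g, f (0, 1), ?_, fun ψ v hψ ↦ ?_⟩
  · by_contra! hcon
    refine hf0 (LinearMap.ext fun p ↦ ?_)
    rw [hfp, ← hg, hcon.1, hcon.2, inner_zero_left, zero_mul, add_zero, LinearMap.zero_apply]
  · rw [hg, ← hfp]
    exact hf (Submodule.subset_span ⟨ψ, v, hψ, rfl⟩)

/-- The component of `Λ` orthogonal to the unit vector `T`. -/
noncomputable def normalPart (Λ T : E3) : E3 := Λ - ⟪Λ, T⟫ • T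

theorem continuous_normalPart {T : ℝ → E3} (hT : Continuous T) (Λ : E3) :
    Continuous fun s ↦ normalPart Λ (T s) := by
  unfold normalPart
  fun_prop

theorem integrable_smul_test {ψ : ℝ → ℝ} (hψ : Continuous ψ) {f : ℝ → E3}
    (hf : LocallyIntegrable f volume) : IntegrableOn (fun s ↦ ψ s • f s) (Ioo 0 L) volume :=
  ((hf.integrableOn_isCompact isCompact_Icc).continuousOn_smul hψ.continuousOn isCompact_Icc).mono_set
    Ioo_subset_Icc_self

theorem inner_firstVariation_fst (hw : IsAdmissible L P V₀ V₁ w) {ψ : ℝ → ℝ} (hψ : Continuous ψ)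
    (Λ v : E3) : ⟪Λ, (firstVariation L V₀ w ψ v).1⟫ =
      ⟪v, ∫ s in Ioo 0 L, ψ s • normalPart Λ (tangent V₀ w s)⟫ := by
  have hT := hw.isPrimitive.continuous
  have h1 : IntegrableOn (fun s ↦ ψ s • v - ⟪tangent V₀ w s, ψ s • v⟫ • tangent V₀ w s)
      (Ioo 0 L) volume := by
    have hc : Continuous fun s ↦ ψ s • v - ⟪tangent V₀ w s, ψ s • v⟫ • tangent V₀ w s := by
      fun_prop
    exact (hc.continuousOn.integrableOn_compact isCompact_Icc).mono_set Ioo_subset_Icc_self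
  rw [firstVariation, ← integral_inner h1,
    ← integral_inner (integrable_smul_test hψ (continuous_normalPart hT Λ).locallyIntegrable)]
  refine integral_congr_ae (ae_of_all _ fun s ↦ ?_)
  simp only [normalPart, inner_sub_right, inner_smul_right, real_inner_comm]
  ring

theorem firstVariation_snd (hw : IsAdmissible L P V₀ V₁ w) {ψ : ℝ → ℝ} (hψ : ContDiff ℝ ∞ ψ)
    (v : E3) : (firstVariation L V₀ w ψ v).2 =
      2 * (⟪v, ∫ s in Ioo 0 L, deriv ψ s • w s⟫ -
        ⟪v, ∫ s in Ioo 0 L, ψ s • ‖w s‖ ^ 2 • tangent V₀ w s⟫) := by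
  have h1 := integrable_smul_test (L := L) (hψ.continuous_deriv (by simp))
    hw.integrable.locallyIntegrable
  have h2 : IntegrableOn (fun s ↦ ψ s • ‖w s‖ ^ 2 • tangent V₀ w s) (Ioo 0 L) volume :=
    integrable_smul_test hψ.continuous (by
      rw [← locallyIntegrableOn_univ]
      exact ((integrable_norm_sq hw.memLp).locallyIntegrable.locallyIntegrableOn _).smul_continuousOn
        isOpen_univ.isLocallyClosed hw.isPrimitive.continuous.continuousOn)
  rw [firstVariation, ← integral_inner h1, ← integral_inner h2,
    ← integral_sub (h1.const_inner v) (h2.const_inner v)]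
  change 2 * _ = 2 * _
  congr 1
  refine integral_congr_ae (ae_of_all _ fun s ↦ ?_)
  simp only [inner_smul_right, real_inner_comm]
  ring

/-- Excludes the abnormal case: the normal part of `Λ` along the curve would vanish, making the
tangent constant. -/
theorem multiplier_ne_zero (hw : IsAdmissible L P V₀ V₁ w)
    (hconst : ¬ ∃ c, ∀ s ∈ Ioo 0 L, tangent V₀ w s = c) {Λ : E3} (hΛ : Λ ≠ 0) :
    ¬ ∀ ψ v, IsTestFunction L ψ → ⟪Λ, (firstVariation L V₀ w ψ v).1⟫ = 0 := by
  intro h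
  have hT := hw.isPrimitive.continuous
  have hN := continuous_normalPart hT Λ
  have h0 : (fun s ↦ normalPart Λ (tangent V₀ w s)) =ᵐ[volume.restrict (Ioo 0 L)] fun _ ↦ 0 := by
    refine ae_eq_of_forall_testFunction_smul (hN.locallyIntegrable.locallyIntegrableOn _)
      (continuous_const.locallyIntegrable.locallyIntegrableOn _) fun ψ h1 h2 h3 ↦ ?_
    refine ext_inner_left ℝ fun v ↦ ?_
    rw [← inner_firstVariation_fst hw h1.continuous, h ψ v ⟨h1, h2, h3⟩]
    simp
  have h1 := Measure.eqOn_Ioo_of_ae_eq volume h0 hN.continuousOn continuousOn_const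
  exact hconst (exists_eq_const_of_forall_eq_inner_smul isPreconnected_Ioo hT.continuousOn
    (fun s _ ↦ hw.norm_tangent s) hΛ fun s hs ↦ sub_eq_zero.1 (h1 hs))

/-- A local minimizer whose tangent is not constant is an elastica. -/
theorem exists_isElastica (hL : 0 < L) (hw : IsAdmissible L P V₀ V₁ w)
    (hmin : IsLocalMinField L P V₀ V₁ w)
    (hconst : ¬ ∃ c, ∀ s ∈ Ioo 0 L, tangent V₀ w s = c) :
    ∃ Λ K, IsElastica L Λ (tangent V₀ w) K ∧ w =ᵐ[volume.restrict (Ioo 0 L)] K := by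
  obtain ⟨Λ', m, hne, hmul⟩ := exists_multiplier hL hw hmin
  have hm : m ≠ 0 := by
    rintro rfl
    refine multiplier_ne_zero hw hconst (hne.resolve_right (by simp)) fun ψ v hψ ↦ ?_
    simpa using hmul ψ v hψ
  have hT := hw.isPrimitive.continuous
  -- Division by `2 * m` normalizes the energy multiplier; the sign is the one for which `g` becomes
  -- `elasticaField Λ` along the curve.
  set Λ := -(2 * m)⁻¹ • Λ' with hΛ
  set g : ℝ → E3 := fun s ↦ -(‖w s‖ ^ 2 • tangent V₀ w s + normalPart Λ (tangent V₀ w s)) with hg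
  have hli : LocallyIntegrable (fun s ↦ ‖w s‖ ^ 2 • tangent V₀ w s) volume := by
    rw [← locallyIntegrableOn_univ]
    exact ((integrable_norm_sq hw.memLp).locallyIntegrable.locallyIntegrableOn _).smul_continuousOn
      isOpen_univ.isLocallyClosed hT.continuousOn
  have hNc := continuous_normalPart hT Λ
  have hgi : LocallyIntegrable g volume := (hli.add hNc.locallyIntegrable).neg
  have hweak : IsWeakDeriv L w g := by
    refine ⟨hw.integrable.locallyIntegrable.locallyIntegrableOn _, hgi.locallyIntegrableOn _,
      fun ψ h1 h2 h3 ↦ ext_inner_left ℝ fun v ↦ ?_⟩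
    have h4 := hmul ψ v ⟨h1, h2, h3⟩
    rw [inner_firstVariation_fst hw h1.continuous, firstVariation_snd hw h1] at h4
    have h5 : ∫ s in Ioo 0 L, ψ s • g s =
        -(∫ s in Ioo 0 L, ψ s • ‖w s‖ ^ 2 • tangent V₀ w s) +
          (2 * m)⁻¹ • ∫ s in Ioo 0 L, ψ s • normalPart Λ' (tangent V₀ w s) := by
      have h6 : ∀ s, ψ s • g s = -(ψ s • ‖w s‖ ^ 2 • tangent V₀ w s) +
          (2 * m)⁻¹ • ψ s • normalPart Λ' (tangent V₀ w s) := fun s ↦ by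
        simp only [hg, hΛ, normalPart, inner_smul_left, conj_trivial]
        module
      simp only [h6]
      have i1 : IntegrableOn (fun s ↦ -(ψ s • ‖w s‖ ^ 2 • tangent V₀ w s)) (Ioo 0 L) :=
        (integrable_smul_test (L := L) h1.continuous hli).fun_neg
      have i2 : IntegrableOn (fun s ↦ (2 * m)⁻¹ • ψ s • normalPart Λ' (tangent V₀ w s)) (Ioo 0 L) :=
        (integrable_smul_test (L := L) h1.continuous
          (continuous_normalPart hT Λ').locallyIntegrable).fun_smul _
      rw [integral_add i1 i2, integral_smul, integral_neg]
    rw [h5, inner_neg_right, inner_add_right, inner_neg_right, inner_smul_right]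
    field_simp
    linarith
  -- Bootstrap: `g` is a priori only locally integrable, which gives `w` a continuous representative
  -- `K`. Then `g` agrees almost everywhere with a continuous function of `T` and `K`, so `K` is
  -- differentiable on `(0, L)`.
  obtain ⟨c, hc⟩ := hweak.exists_ae_eq_primitive hL (ae_eq_refl g) (isPrimitive_integral hgi 0)
  set K : ℝ → E3 := fun s ↦ c + (0 + ∫ t in (0 : ℝ)..s, g t) with hK
  have hKc : Continuous K := continuous_const.add (isPrimitive_integral hgi 0).continuous
  have hwK : ∀ᵐ s, s ∈ Ioo 0 L → w s = K s := (ae_restrict_iff' measurableSet_Ioo).1 hc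
  have hint : ∀ {f f' : ℝ → E3}, (∀ᵐ s, s ∈ Ioo 0 L → f s = f' s) → ∀ s ∈ Ioo 0 L,
      ∫ t in (0 : ℝ)..s, f t = ∫ t in (0 : ℝ)..s, f' t := by
    intro f f' h s hs
    refine intervalIntegral.integral_congr_ae ?_
    filter_upwards [h] with t ht ht'
    rw [uIoc_of_le hs.1.le] at ht'
    exact ht ⟨ht'.1, ht'.2.trans_lt hs.2⟩
  refine ⟨Λ, K, ⟨hT, hKc, hw.norm_tangent, fun s hs ↦ ?_, fun s hs ↦ ?_⟩, hc⟩
  · refine (hasDerivAt_integral_of_continuous hKc V₀ s).congr_of_eventuallyEq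
      (eventually_of_mem (Ioo_mem_nhds hs.1 hs.2) fun t ht ↦ ?_)
    rw [tangent, hint hwK t ht]
  · have hFc : Continuous fun s ↦ elasticaField Λ (tangent V₀ w s, K s) :=
      (contDiff_elasticaField Λ).continuous.comp (hT.prodMk hKc)
    refine (hasDerivAt_integral_of_continuous hFc c s).congr_of_eventuallyEq
      (eventually_of_mem (Ioo_mem_nhds hs.1 hs.2) fun t ht ↦ ?_)
    have hgF : ∀ᵐ s, s ∈ Ioo 0 L → g s = elasticaField Λ (tangent V₀ w s, K s) := by
      filter_upwards [hwK] with x hx hx'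
      rw [← hx hx']
      rfl
    change c + (0 + ∫ s in (0 : ℝ)..t, g s) = _
    rw [zero_add, hint hgF t ht]

end EulerLagrange

/-! ### Small rotations about an axis. -/

theorem reflection_span_singleton_of_norm_eq_one {u : E3} (hu : ‖u‖ = 1) (x : E3) :
    (ℝ ∙ u).reflection x = (2 * ⟪u, x⟫) • u - x := by
  rw [Submodule.reflection_singleton_apply, hu]
  simp [two_smul, two_mul, add_smul]

theorem exists_unit_orthogonal (e a : E3) : ∃ b : E3, ‖b‖ = 1 ∧ ⟪b, e⟫ = 0 ∧ ⟪b, a⟫ = 0 := by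
  have hne : (Submodule.span ℝ {e, a})ᗮ ≠ ⊥ := by
    intro h
    rw [Submodule.orthogonal_eq_bot_iff] at h
    have h1 : Module.finrank ℝ (Submodule.span ℝ ({e, a} : Set E3)) ≤ 2 := by
      classical
      have := finrank_span_finset_le_card (R := ℝ) ({e, a} : Finset E3)
      rw [Finset.coe_pair] at this
      exact this.trans Finset.card_le_two
    rw [h, finrank_top, finrank_euclideanSpace_fin] at h1
    omega
  obtain ⟨b, hb, hb0⟩ := Submodule.exists_mem_ne_zero_of_ne_bot hne
  have h1 := (Submodule.mem_orthogonal' _ _).1 hb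
  refine ⟨‖b‖⁻¹ • b, ?_, ?_, ?_⟩
  · rw [norm_smul, norm_inv, norm_norm, inv_mul_cancel₀ (norm_ne_zero_iff.2 hb0)]
  · rw [inner_smul_left, h1 e (Submodule.subset_span (by simp)), mul_zero]
  · rw [inner_smul_left, h1 a (Submodule.subset_span (by simp)), mul_zero]

/-- Rotations about the axis `e` close to the identity that move a given vector `a ⊥ e`. -/
theorem exists_rotation {e a : E3} (ha : a ≠ 0) (hea : ⟪a, e⟫ = 0) {ε : ℝ} (hε : 0 < ε) :
    ∃ R : E3 ≃ₗᵢ[ℝ] E3, R e = e ∧ R a ≠ a ∧ ∀ x, ‖R x - x‖ ≤ ε * ‖x‖ := by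
  obtain ⟨b, hb, hbe, hba⟩ := exists_unit_orthogonal e a
  have han : ‖a‖ ≠ 0 := norm_ne_zero_iff.2 ha
  obtain ⟨u, hun, hue, hbu, hua⟩ : ∃ u : E3, ‖u‖ = 1 ∧ ⟪u, e⟫ = 0 ∧ ⟪b, u⟫ = 0 ∧ ⟪u, a⟫ = ‖a‖ := by
    refine ⟨‖a‖⁻¹ • a, ?_, ?_, ?_, ?_⟩
    · rw [norm_smul, norm_inv, norm_norm, inv_mul_cancel₀ han]
    · rw [inner_smul_left, hea, mul_zero]
    · rw [inner_smul_right, hba, mul_zero]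
    · rw [inner_smul_left, real_inner_self_eq_norm_sq, conj_trivial]
      field_simp
  -- The bound `1` makes sine and cosine positive; `ε / 8` matches the constant `8 * θ` in the final
  -- estimate.
  set θ := min 1 (ε / 8)
  have hθ0 : 0 < θ := by positivity
  have hθ1 : θ ≤ 1 := min_le_left _ _
  have hθε : θ ≤ ε / 8 := min_le_right _ _
  have hcos := Real.cos_pos_of_le_one (abs_le.2 ⟨by linarith, hθ1⟩)
  have hsin := Real.sin_pos_of_pos_of_le_one hθ0 hθ1
  set v : E3 := Real.cos θ • u + Real.sin θ • b with hv
  have hvn : ‖v‖ = 1 := by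
    have : ‖v‖ ^ 2 = 1 := by
      rw [hv, norm_add_sq_real, norm_smul, norm_smul, hun, hb, inner_smul_left, inner_smul_right,
        real_inner_comm, hbu]
      simp
    exact (pow_eq_one_iff_of_nonneg (norm_nonneg v) two_ne_zero).1 this
  have hve : ⟪v, e⟫ = 0 := by
    rw [hv, inner_add_left, inner_smul_left, inner_smul_left, hue, hbe, mul_zero, mul_zero, add_zero]
  have hva : ⟪v, a⟫ = Real.cos θ * ‖a‖ := by
    rw [hv, inner_add_left, inner_smul_left, inner_smul_left, hua, hba, mul_zero, add_zero,
      conj_trivial]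
  have huv : ‖v - u‖ ≤ 2 * θ := by
    have e1 : v - u = (Real.cos θ - 1) • u + Real.sin θ • b := by rw [hv]; module
    rw [e1]
    refine (norm_add_le _ _).trans ?_
    rw [norm_smul, norm_smul, hun, hb, mul_one, mul_one, Real.norm_eq_abs, Real.norm_eq_abs,
      abs_of_pos hsin, abs_of_nonpos (by linarith [Real.cos_le_one θ])]
    have h1 := Real.one_sub_sq_div_two_le_cos (x := θ)
    have h2 := Real.sin_le hθ0.le
    nlinarith
  have hu_refl := reflection_span_singleton_of_norm_eq_one hun
  have hv_refl := reflection_span_singleton_of_norm_eq_one hvn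
  -- The product of the half-turns about two lines orthogonal to `e` at angle `θ` is a rotation
  -- about `e` by an angle of size `2θ`; each half-turn sends `e` to `-e`.
  refine ⟨((ℝ ∙ v).reflection).trans (ℝ ∙ u).reflection, ?_, fun hcon ↦ ?_, fun x ↦ ?_⟩
  · rw [LinearIsometryEquiv.trans_apply, hv_refl, hve, hu_refl]
    simp [hue, inner_neg_right]
  · rw [LinearIsometryEquiv.trans_apply] at hcon
    have h1 : (ℝ ∙ v).reflection a = (ℝ ∙ u).reflection a := by
      rw [← hcon, Submodule.reflection_reflection, hcon]
    rw [hu_refl, hv_refl, sub_left_inj] at h1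
    -- If `a` were fixed, both half-turns would agree on it, but only the one about `v` gives `a` a
    -- nonzero component along `b`.
    have h2 := congrArg (fun x ↦ ⟪b, x⟫) h1
    simp only [inner_smul_right, hbu, mul_zero, hva] at h2
    rw [hv, inner_add_right, inner_smul_right, inner_smul_right, hbu,
      real_inner_self_eq_norm_sq, hb] at h2
    have : 0 < 2 * (Real.cos θ * ‖a‖) * (Real.cos θ * 0 + Real.sin θ * 1 ^ 2) := by
      have : 0 < ‖a‖ := norm_pos_iff.2 ha
      rw [mul_zero, zero_add, one_pow, mul_one]
      positivity
    linarith
  · rw [LinearIsometryEquiv.trans_apply]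
    nth_rewrite 2 [← Submodule.reflection_reflection (ℝ ∙ u) x]
    rw [← map_sub, LinearIsometryEquiv.norm_map, hu_refl, hv_refl, sub_sub_sub_cancel_right]
    have e1 : (2 * ⟪v, x⟫) • v - (2 * ⟪u, x⟫) • u =
        (2 * ⟪v, x⟫) • (v - u) + (2 * ⟪v - u, x⟫) • u := by
      rw [inner_sub_left]; module
    rw [e1]
    refine (norm_add_le _ _).trans ?_
    rw [norm_smul, norm_smul, norm_mul, norm_mul, hun, Real.norm_ofNat]
    have h1 : ‖⟪v, x⟫‖ ≤ 1 * ‖x‖ := hvn ▸ norm_inner_le_norm v x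
    have h2 : ‖⟪v - u, x⟫‖ ≤ 2 * θ * ‖x‖ := (norm_inner_le_norm _ x).trans (by gcongr)
    calc 2 * ‖⟪v, x⟫‖ * ‖v - u‖ + 2 * ‖⟪v - u, x⟫‖ * 1
        ≤ 2 * (1 * ‖x‖) * (2 * θ) + 2 * (2 * θ * ‖x‖) * 1 := by gcongr
      _ = 8 * θ * ‖x‖ := by ring
      _ ≤ ε * ‖x‖ := by gcongr; linarith

/-! ### Rotating an arc of the curve. -/

section Rotation

variable {L : ℝ} {P V₀ V₁ : E3} {w : ℝ → E3} {s₁ s₂ : ℝ} {R : E3 ≃ₗᵢ[ℝ] E3}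

/-- The curvature vector field after rotating the arc over `(s₁, s₂)` by `R`. -/
noncomputable def rotatedField (s₁ s₂ : ℝ) (R : E3 ≃ₗᵢ[ℝ] E3) (w : ℝ → E3) (s : ℝ) : E3 :=
  open Classical in if s ∈ Ioo s₁ s₂ then R (w s) else w s

theorem rotatedField_of_mem {s : ℝ} (hs : s ∈ Ioo s₁ s₂) : rotatedField s₁ s₂ R w s = R (w s) :=
  if_pos hs

theorem rotatedField_of_notMem {s : ℝ} (hs : s ∉ Ioo s₁ s₂) : rotatedField s₁ s₂ R w s = w s :=
  if_neg hs

theorem norm_rotatedField (s : ℝ) : ‖rotatedField s₁ s₂ R w s‖ = ‖w s‖ := by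
  by_cases hs : s ∈ Ioo s₁ s₂
  · rw [rotatedField_of_mem hs, R.norm_map]
  · rw [rotatedField_of_notMem hs]

theorem norm_rotatedField_sub_le {ε : ℝ} (hε : 0 < ε) (hR : ∀ x, ‖R x - x‖ ≤ ε * ‖x‖) (s : ℝ) :
    ‖rotatedField s₁ s₂ R w s - w s‖ ≤ ε * ‖w s‖ := by
  by_cases hs : s ∈ Ioo s₁ s₂
  · rw [rotatedField_of_mem hs]
    exact hR _
  · rw [rotatedField_of_notMem hs, sub_self, norm_zero]
    positivity

theorem memLp_rotatedField (hw : MemLp w 2 volume) : MemLp (rotatedField s₁ s₂ R w) 2 volume := by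
  refine hw.of_le ?_ (ae_of_all _ fun s ↦ (norm_rotatedField s).le)
  classical
  have : rotatedField s₁ s₂ R w = (Ioo s₁ s₂).piecewise (fun s ↦ R (w s)) w := by
    ext1 s
    by_cases hs : s ∈ Ioo s₁ s₂
    · rw [rotatedField_of_mem hs, piecewise_eq_of_mem _ _ _ hs]
    · rw [rotatedField_of_notMem hs, piecewise_eq_of_notMem _ _ _ hs]
  rw [this]
  exact AEStronglyMeasurable.piecewise measurableSet_Ioo
    (R.continuous.comp_aestronglyMeasurable hw.1).restrict hw.1.restrict

theorem rotatedField_eq_zero (h : ∀ s, s ∉ Ioo 0 L → w s = 0) {s : ℝ} (hs : s ∉ Ioo 0 L) :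
    rotatedField s₁ s₂ R w s = 0 := by
  rw [← norm_eq_zero, norm_rotatedField, h s hs, norm_zero]

theorem tangent_rotatedField_of_le (hs₁ : 0 ≤ s₁) {s : ℝ}
    (hs : s ≤ s₁) : tangent V₀ (rotatedField s₁ s₂ R w) s = tangent V₀ w s := by
  rw [tangent, tangent]
  congr 1
  refine intervalIntegral.integral_congr fun t ht ↦ rotatedField_of_notMem fun ht' ↦ ?_
  rcases mem_uIcc.1 ht with h | h <;> linarith [h.2, ht'.1]

/-- `R` commutes with integration from `s₁` and fixes the tangent there. -/
theorem tangent_rotatedField_of_mem (hw : IsAdmissible L P V₀ V₁ w) (hs₁ : 0 ≤ s₁)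
    (hR : R (tangent V₀ w s₁) = tangent V₀ w s₁) {s : ℝ} (hs : s ∈ Icc s₁ s₂) :
    tangent V₀ (rotatedField s₁ s₂ R w) s = R (tangent V₀ w s) := by
  have hi := integrable_of_memLp_two (memLp_rotatedField (R := R) (s₁ := s₁) (s₂ := s₂) hw.memLp)
    fun s hs ↦ rotatedField_eq_zero hw.eq_zero hs
  have h1 := (isPrimitive_tangent hi V₀).2 s₁ s
  have h2 : ∫ t in s₁..s, rotatedField s₁ s₂ R w t = ∫ t in s₁..s, R (w t) := by
    refine intervalIntegral.integral_congr_ae ?_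
    filter_upwards [compl_mem_ae_iff.2 (measure_singleton s)] with t ht ht'
    rw [uIoc_of_le hs.1] at ht'
    exact rotatedField_of_mem ⟨ht'.1, (lt_of_le_of_ne ht'.2 ht).trans_le hs.2⟩
  have h3 : ∫ t in s₁..s, R (w t) = R (∫ t in s₁..s, w t) :=
    R.toContinuousLinearEquiv.toContinuousLinearMap.intervalIntegral_comp_comm
      hw.integrable.intervalIntegrable
  rw [h2, h3, hw.isPrimitive.2, map_sub, hR, tangent_rotatedField_of_le hs₁ le_rfl] at h1
  exact (sub_left_injective h1).symm

theorem tangent_rotatedField_of_ge (hw : IsAdmissible L P V₀ V₁ w) (hs₁ : 0 ≤ s₁) (hs : s₁ ≤ s₂)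
    (hR₁ : R (tangent V₀ w s₁) = tangent V₀ w s₁) (hR₂ : R (tangent V₀ w s₂) = tangent V₀ w s₂)
    {s : ℝ} (h : s₂ ≤ s) : tangent V₀ (rotatedField s₁ s₂ R w) s = tangent V₀ w s := by
  have hi := integrable_of_memLp_two (memLp_rotatedField (R := R) (s₁ := s₁) (s₂ := s₂) hw.memLp)
    fun s hs ↦ rotatedField_eq_zero hw.eq_zero hs
  have h1 := (isPrimitive_tangent hi V₀).2 s₂ s
  have h2 : ∫ t in s₂..s, rotatedField s₁ s₂ R w t = ∫ t in s₂..s, w t := by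
    refine intervalIntegral.integral_congr fun t ht ↦ rotatedField_of_notMem fun ht' ↦ ?_
    rw [uIcc_of_le h] at ht
    linarith [ht.1, ht'.2]
  rw [h2, hw.isPrimitive.2, tangent_rotatedField_of_mem hw hs₁ hR₁ ⟨hs, le_rfl⟩, hR₂] at h1
  exact (sub_left_injective h1).symm

/-- Fixing the two tangents keeps the tangent continuous at the ends of the arc and unchanged
outside it; fixing the chord keeps the total displacement. -/
theorem isAdmissible_rotatedField (hw : IsAdmissible L P V₀ V₁ w) (hs₁ : 0 ≤ s₁) (hs : s₁ ≤ s₂)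
    (hs₂ : s₂ ≤ L)
    (hR₁ : R (tangent V₀ w s₁) = tangent V₀ w s₁) (hR₂ : R (tangent V₀ w s₂) = tangent V₀ w s₂)
    (hR : R (∫ s in s₁..s₂, tangent V₀ w s) = ∫ s in s₁..s₂, tangent V₀ w s) :
    IsAdmissible L P V₀ V₁ (rotatedField s₁ s₂ R w) := by
  have hm := memLp_rotatedField (R := R) (s₁ := s₁) (s₂ := s₂) hw.memLp
  have hz : ∀ s, s ∉ Ioo 0 L → rotatedField s₁ s₂ R w s = 0 :=
    fun s hs ↦ rotatedField_eq_zero hw.eq_zero hs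
  have hc := (isPrimitive_tangent (integrable_of_memLp_two hm hz) V₀).continuous
  have hT := hw.isPrimitive.continuous
  have e1 : ∀ s, s ≤ s₁ → tangent V₀ (rotatedField s₁ s₂ R w) s = tangent V₀ w s :=
    fun s ↦ tangent_rotatedField_of_le hs₁
  have e2 : ∀ s ∈ Icc s₁ s₂, tangent V₀ (rotatedField s₁ s₂ R w) s = R (tangent V₀ w s) :=
    fun s ↦ tangent_rotatedField_of_mem hw hs₁ hR₁
  have e3 : ∀ s, s₂ ≤ s → tangent V₀ (rotatedField s₁ s₂ R w) s = tangent V₀ w s :=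
    fun s ↦ tangent_rotatedField_of_ge hw hs₁ hs hR₁ hR₂
  refine ⟨hm, hz, fun s ↦ ?_, ?_, ?_⟩
  · rcases le_total s s₁ with h1 | h1
    · rw [e1 s h1, hw.norm_tangent]
    rcases le_total s₂ s with h2 | h2
    · rw [e3 s h2, hw.norm_tangent]
    · rw [e2 s ⟨h1, h2⟩, R.norm_map, hw.norm_tangent]
  · rw [e3 L hs₂, hw.tangent_end]
  · have i1 : ∫ s in (0 : ℝ)..s₁, tangent V₀ (rotatedField s₁ s₂ R w) s =
        ∫ s in (0 : ℝ)..s₁, tangent V₀ w s := intervalIntegral.integral_congr fun s h ↦ by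
      rw [uIcc_of_le hs₁] at h
      exact e1 s h.2
    have i2 : ∫ s in s₁..s₂, tangent V₀ (rotatedField s₁ s₂ R w) s =
        ∫ s in s₁..s₂, R (tangent V₀ w s) := intervalIntegral.integral_congr fun s h ↦ by
      rw [uIcc_of_le hs] at h
      exact e2 s h
    have i2' : ∫ s in s₁..s₂, R (tangent V₀ w s) = R (∫ s in s₁..s₂, tangent V₀ w s) :=
      R.toContinuousLinearEquiv.toContinuousLinearMap.intervalIntegral_comp_comm
        (hT.intervalIntegrable _ _)
    have i3 : ∫ s in s₂..L, tangent V₀ (rotatedField s₁ s₂ R w) s =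
        ∫ s in s₂..L, tangent V₀ w s := intervalIntegral.integral_congr fun s h ↦ by
      rw [uIcc_of_le hs₂] at h
      exact e3 s h.1
    rw [← hw.integral_tangent,
      ← intervalIntegral.integral_add_adjacent_intervals (hc.intervalIntegrable 0 s₁)
        (hc.intervalIntegrable s₁ L),
      ← intervalIntegral.integral_add_adjacent_intervals (hc.intervalIntegrable s₁ s₂)
        (hc.intervalIntegrable s₂ L),
      ← intervalIntegral.integral_add_adjacent_intervals (hT.intervalIntegrable 0 s₁)
        (hT.intervalIntegrable s₁ L),
      ← intervalIntegral.integral_add_adjacent_intervals (hT.intervalIntegrable s₁ s₂)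
        (hT.intervalIntegrable s₂ L), i1, i2, i2', i3, hR]

end Rotation

/-! ### Transfer of local minimality and the final contradiction. -/

theorem exists_pos_sq_mul_lt {E δ : ℝ} (hE : 0 ≤ E) (hδ : 0 < δ) : ∃ ε > 0, ε ^ 2 * E < δ / 4 := by
  refine ⟨Real.sqrt (δ / (4 * (E + 1))), Real.sqrt_pos.2 (by positivity), ?_⟩
  rw [Real.sq_sqrt (by positivity), div_mul_eq_mul_div, div_lt_div_iff₀ (by positivity) (by norm_num)]
  nlinarith

/-- Fields near `w₁` are still within the neighbourhood in which `w` is minimal, and the energies of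
`w` and `w₁` agree. The quarters come from `‖a + b‖² ≤ 2‖a‖² + 2‖b‖²`. -/
theorem isLocalMinField_of_close {L δ : ℝ} {P V₀ V₁ : E3} {w w₁ : ℝ → E3} (hδ : 0 < δ)
    (hw : MemLp w 2 volume) (hw₁ : MemLp w₁ 2 volume)
    (hmin : ∀ w', IsAdmissible L P V₀ V₁ w' → ∫ s, ‖w' s - w s‖ ^ 2 < δ →
      ∫ s, ‖w s‖ ^ 2 ≤ ∫ s, ‖w' s‖ ^ 2)
    (hE : ∫ s, ‖w₁ s‖ ^ 2 = ∫ s, ‖w s‖ ^ 2) (hclose : ∫ s, ‖w₁ s - w s‖ ^ 2 < δ / 4) :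
    IsLocalMinField L P V₀ V₁ w₁ := by
  refine ⟨δ / 4, by positivity, fun w' hw' hlt ↦ ?_⟩
  rw [hE]
  refine hmin w' hw' ?_
  have i1 : Integrable (fun s ↦ ‖w' s - w₁ s‖ ^ 2) volume := integrable_norm_sq (hw'.memLp.sub hw₁)
  have i2 : Integrable (fun s ↦ ‖w₁ s - w s‖ ^ 2) volume := integrable_norm_sq (hw₁.sub hw)
  have i3 : Integrable (fun s ↦ ‖w' s - w s‖ ^ 2) volume := integrable_norm_sq (hw'.memLp.sub hw)
  calc ∫ s, ‖w' s - w s‖ ^ 2 ≤ ∫ s, (2 * ‖w' s - w₁ s‖ ^ 2 + 2 * ‖w₁ s - w s‖ ^ 2) := by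
        refine integral_mono i3 ((i1.const_mul 2).add (i2.const_mul 2)) fun s ↦ ?_
        have h1 : ‖w' s - w s‖ ≤ ‖w' s - w₁ s‖ + ‖w₁ s - w s‖ := norm_sub_le_norm_sub_add_norm_sub _ _ _
        have h2 := norm_nonneg (w' s - w s)
        nlinarith [sq_nonneg (‖w' s - w₁ s‖ - ‖w₁ s - w s‖)]
    _ = 2 * (∫ s, ‖w' s - w₁ s‖ ^ 2) + 2 * ∫ s, ‖w₁ s - w s‖ ^ 2 := by
        rw [integral_add (i1.const_mul 2) (i2.const_mul 2), integral_const_mul, integral_const_mul]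
    _ < δ := by linarith

/-- A constant unit tangent would give a displacement of length exactly `L`. -/
theorem IsAdmissible.not_constant {L : ℝ} (hL : 0 < L) {P V₀ V₁ : E3} {w : ℝ → E3}
    (hw : IsAdmissible L P V₀ V₁ w) (hP : ‖P‖ < L) :
    ¬ ∃ c, ∀ s ∈ Ioo 0 L, tangent V₀ w s = c := by
  rintro ⟨c, hc⟩
  have h1 : ‖c‖ = 1 := by
    rw [← hc (L / 2) ⟨by linarith, by linarith⟩, hw.norm_tangent]
  have h2 : P = L • c := by
    rw [← hw.integral_tangent, intervalIntegral.integral_of_le hL.le, integral_Ioc_eq_integral_Ioo,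
      setIntegral_congr_fun measurableSet_Ioo hc]
    simp [hL.le]
  rw [h2, norm_smul, h1, mul_one, Real.norm_of_nonneg hL.le] at hP
  exact lt_irrefl _ hP

end Elastica

open Elastica

/-- Here `derivIcc L (derivIcc L γ) s` is the classical second derivative of `γ` at `s`; that it is
nonzero includes that it exists, and no further regularity of `γ` is assumed. -/
theorem theorem7p2 (L : ℝ) (hL : 0 < L) (P₀ P₁ V₀ V₁ : Elastica.E3)
    (hP : ‖P₀ - P₁‖ < L) (hV₀ : ‖V₀‖ = 1) (hV₁ : ‖V₁‖ = 1)
    (γ : ℝ → Elastica.E3) (hγ : γ ∈ Elastica.clampedCurves L P₀ P₁ V₀ V₁)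
    (s₁ s₂ : ℝ) (hs₁ : 0 ≤ s₁) (hs₁₂ : s₁ < s₂) (hs₂ : s₂ ≤ L) (hlt : s₂ - s₁ < L)
    (hpar : Elastica.AreParallel (γ s₂ - γ s₁)
      (Elastica.derivIcc L γ s₁) (Elastica.derivIcc L γ s₂))
    (hcurv : Elastica.derivIcc L (Elastica.derivIcc L γ) s₁ ≠ 0 ∨
      Elastica.derivIcc L (Elastica.derivIcc L γ) s₂ ≠ 0) :
    ¬ Elastica.IsLocalMinimizer L (Elastica.clampedCurves L P₀ P₁ V₀ V₁) γ := by
  intro hloc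
  obtain ⟨w, hw, hγw⟩ := exists_isAdmissible hL hγ
  have hPn : ‖P₁ - P₀‖ < L := by rwa [norm_sub_rev]
  have hmin := isLocalMinField_of_isLocalMinimizer hL hloc hw hγw
  obtain ⟨Λ, K, hel, hwK⟩ := exists_isElastica hL hw hmin (hw.not_constant hL hPn)
  have hT := hw.isPrimitive.continuous
  have hm₁ : s₁ ∈ Icc 0 L := ⟨hs₁, hs₁₂.le.trans hs₂⟩
  have hm₂ : s₂ ∈ Icc 0 L := ⟨hs₁.trans hs₁₂.le, hs₂⟩
  have hd1 : EqOn (derivIcc L γ) (tangent V₀ w) (Icc 0 L) := fun s hs ↦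
    derivIcc_eq hL hs hγw (hasDerivAt_integral_of_continuous hT P₀ s)
  have hTK : EqOn (tangent V₀ w) (fun s ↦ V₀ + ∫ t in (0 : ℝ)..s, K t) (Icc 0 L) := by
    intro s hs
    rw [tangent]
    congr 1
    rw [intervalIntegral.integral_of_le hs.1, intervalIntegral.integral_of_le hs.1,
      integral_Ioc_eq_integral_Ioo, integral_Ioc_eq_integral_Ioo]
    exact integral_congr_ae (ae_restrict_of_ae_restrict_of_subset (Ioo_subset_Ioo_right hs.2) hwK)
  -- By regularity the classical second derivative exists on all of `[0, L]`, endpoints included, so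
  -- `hcurv` becomes a statement about `K`.
  have hd2 : ∀ s ∈ Icc 0 L, derivIcc L (derivIcc L γ) s = K s := fun s hs ↦
    derivIcc_eq hL hs (hd1.trans hTK)
      (hasDerivAt_integral_of_continuous hel.continuous_curvature V₀ s)
  have horth : EqOn (fun s ↦ inner ℝ (tangent V₀ w s) (K s)) (fun _ ↦ 0) (Icc 0 L) := by
    refine Measure.eqOn_Icc_of_ae_eq volume hL.ne ?_
      (hT.inner hel.continuous_curvature).continuousOn continuousOn_const
    rw [← restrict_Ioo_eq_restrict_Icc]
    filter_upwards [hwK, ae_restrict_of_ae hw.ae_inner_eq_zero] with s h1 h2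
    rw [← h1, h2]
  rw [hd1 hm₁, hd1 hm₂] at hpar
  rw [hd2 s₁ hm₁, hd2 s₂ hm₂] at hcurv
  obtain ⟨e, he, he₁, he₂⟩ := hpar
  obtain ⟨s₀, hs₀, hs₀', hK₀⟩ : ∃ s₀ ∈ Icc s₁ s₂, tangent V₀ w s₀ ∈ Submodule.span ℝ {e} ∧ K s₀ ≠ 0 :=
    hcurv.elim (fun h ↦ ⟨s₁, ⟨le_rfl, hs₁₂.le⟩, he₁, h⟩) fun h ↦ ⟨s₂, ⟨hs₁₂.le, le_rfl⟩, he₂, h⟩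
  have hs₀L : s₀ ∈ Icc 0 L := ⟨hs₁.trans hs₀.1, hs₀.2.trans hs₂⟩
  -- The unit tangent at `s₀` is a nonzero multiple of `e`, and curvature is orthogonal to the
  -- tangent.
  have hKe : inner ℝ (K s₀) e = 0 := by
    obtain ⟨c, hc⟩ := Submodule.mem_span_singleton.1 hs₀'
    have h1 : inner ℝ (tangent V₀ w s₀) (K s₀) = 0 := horth hs₀L
    rw [← hc, inner_smul_left, real_inner_comm] at h1
    refine (mul_eq_zero.1 h1).resolve_left fun h2 ↦ ?_
    have h3 := hw.norm_tangent s₀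
    rw [← hc, show c = 0 from h2, zero_smul, norm_zero] at h3
    exact zero_ne_one h3
  obtain ⟨δ, hδ, hminδ⟩ := hmin
  have hE : 0 ≤ ∫ s, ‖w s‖ ^ 2 := integral_nonneg fun s ↦ by positivity
  obtain ⟨ε, hε, hεE⟩ : ∃ ε > 0, ε ^ 2 * ∫ s, ‖w s‖ ^ 2 < δ / 4 := exists_pos_sq_mul_lt hE hδ
  obtain ⟨R, hRe, hRK, hRε⟩ := exists_rotation hK₀ hKe hε
  have hfix : ∀ x ∈ Submodule.span ℝ {e}, R x = x := fun x hx ↦ by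
    obtain ⟨c, rfl⟩ := Submodule.mem_span_singleton.1 hx
    rw [map_smul, hRe]
  have hint : ∫ s in s₁..s₂, tangent V₀ w s = γ s₂ - γ s₁ := by
    rw [hγw hm₁, hγw hm₂, add_sub_add_left_eq_sub, intervalIntegral.integral_interval_sub_left
      (hT.intervalIntegrable _ _) (hT.intervalIntegrable _ _)]
  have hw' : IsAdmissible L (P₁ - P₀) V₀ V₁ (rotatedField s₁ s₂ R w) :=
    isAdmissible_rotatedField hw hs₁ hs₁₂.le hs₂ (hfix _ he₁) (hfix _ he₂)
      (by rw [hint]; exact hfix _ he)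
  have hmin' : IsLocalMinField L (P₁ - P₀) V₀ V₁ (rotatedField s₁ s₂ R w) := by
    refine isLocalMinField_of_close hδ hw.memLp hw'.memLp hminδ ?_ (lt_of_le_of_lt ?_ hεE)
    · simp only [norm_rotatedField]
    · rw [← integral_const_mul]
      refine integral_mono (integrable_norm_sq (hw'.memLp.sub hw.memLp))
        ((integrable_norm_sq hw.memLp).const_mul _) fun s ↦ ?_
      beta_reduce
      rw [← mul_pow]
      exact pow_le_pow_left₀ (norm_nonneg _) (norm_rotatedField_sub_le hε hRε s) 2
  obtain ⟨Λ', K', hel', hwK'⟩ := exists_isElastica hL hw' hmin' (hw'.not_constant hL hPn)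
  -- The arc is proper: either `(0, s₁)` is nonempty or, when `s₁ = 0`, `(s₂, L)` is. The rotation
  -- leaves the tangent unchanged there.
  have hKK : EqOn K K' (Icc 0 L) := by
    rcases hs₁.lt_or_eq with h | h
    · exact hel.eqOn_of_eqOn_Ioo hel' h (Ioo_subset_Ioo_right hm₁.2) fun s hs ↦
        (tangent_rotatedField_of_le hs₁ hs.2.le).symm
    · exact hel.eqOn_of_eqOn_Ioo hel' (by linarith : s₂ < L) (Ioo_subset_Ioo_left hm₂.1) fun s hs ↦
        (tangent_rotatedField_of_ge hw hs₁ hs₁₂.le (hfix _ he₁) (hfix _ he₂) hs.1.le).symm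
  have hRKK : EqOn (fun s ↦ R (K s)) K' (Icc s₁ s₂) := by
    refine Measure.eqOn_Icc_of_ae_eq volume hs₁₂.ne ?_
      (R.continuous.comp hel.continuous_curvature).continuousOn hel'.continuous_curvature.continuousOn
    rw [← restrict_Ioo_eq_restrict_Icc]
    have hsub : Ioo s₁ s₂ ⊆ Ioo 0 L := Ioo_subset_Ioo hs₁ hs₂
    filter_upwards [ae_restrict_of_ae_restrict_of_subset hsub hwK,
      ae_restrict_of_ae_restrict_of_subset hsub hwK', ae_restrict_mem measurableSet_Ioo] with s h1 h2 h3
    rw [← h1, ← h2, rotatedField_of_mem h3]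
  -- The curvature at `s₀` would be fixed by `R`. As `s₀` is an end of the arc, `R K = K'` holds
  -- there only through continuity up to the closed interval.
  exact hRK ((hRKK hs₀).trans (hKK hs₀L).symm)
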